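/- Let $M_2=\mathbb R^2$ be two-dimensional Minkowski space with points $z=(t,x)$ and measure $dz=dt\,dx$, and let $m>0$, $\mu>0$, $a>0$ with $a^2<4\pi$. Put $\omega(k)=\sqrt{k^2+m^2}$, let $$\Delta_+(t,x)=\lim_{\varepsilon\downarrow0}\frac1{2\pi}\int_{\mathbb R}\frac{dk}{2\omega(k)}\,e^{ikx-i\omega(k)(t-i\varepsilon)}$$ (defined for $t^2\ne x^2$), let $\Delta_F(t,x)=\Delta_+(t,x)$ for $t\ge0$ and $\Delta_F(t,x)=\Delta_+(-t,x)$ for $t<0$, and let $D_\mu=\{(t,x): -\mu<t+x<\mu,\ -\mu<t-x<\mu\}$. For $f:\mathbb R\to\mathbb C$, $g:M_2\to\mathbb R$, $\phi\in\mathcal C:=C^\infty(M_2,\mathbb R)$ and $n\ge0$ let $$S_n(\phi)=\frac{i^n}{n!}\int_{\mathbb R^n}ds\,\prod_{i=1}^n f(s_i)\int_{M_2^n}dz\,\prod_{i=1}^n e^{is_i\phi(z_i)}g(z_i)\;\exp\Big(-\sum_{l<j}s_ls_j\,\Delta_F(z_l-z_j)\Big),$$ that is, $S_n=\frac{i^n}{n!}\mathcal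 T(L_I^{\otimes n})$ is the $n$-th coefficient of the $S$-matrix $S(\lambda L_I)=\sum_n\lambda^nS_n$ of the interaction Lagrangian $L_I(\phi)=\int g(z)\int f(s)e^{is\phi(z)}\,ds\,dz$. Theorem. The function $\Delta_+$ is locally integrable and is the integral kernel of the two-point function of the vacuum of the Klein–Gordon field of mass $m$: for all $h\in C_c^\infty(M_2,\mathbb C)$, $$\int\Delta_+(z)h(z)\,dz=\frac1{2\pi}\int_{\mathbb R}\frac{dk}{2\omega(k)}\int h(t,x)e^{ikx-i\omega(k)t}\,dt\,dx.$$ Moreover, for every $r<a$ there are constants $C,K>0$, depending only on $m,\mu,a,r$, such that the following holds for all $f\in C^\infty(\mathbb R,\mathbb C)$ with $\operatorname{supp}f\subset[-r,r]$ and $\overline{f(s)}=f(-s)$, and all real-valued $g\in C_c^\infty(D_\mu)$ (every $f\in C_c^\infty((-a,a))$ is supported in such an interval $[-r,r]$). 1. For all $\phi\in\mathcal C$ and $n\ge 0$ the integrals that define $S_n(\phi)$ converge absolutely: the inner integrand is integrable over $M_2^n$ for each fixed $s\in(-a,a)^n$, and the whole integrand is integrable over $\mathbb R^n\times M_2^n$.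 2. For all $p\in[1,4\pi/a^2)$, with $\frac1p+\frac1q=1$ (so $q=\infty$ if $p=1$), all $n\ge0$ and all $\phi\in\mathcal C$, $$|S_n(\phi)|\le\frac{\|f\|_1^n}{n!}\,e^{n\frac K2a^2}\,(2\mu)^{n\frac{a^2}{4\pi}}\,\|g\|_q^n\,(C^n\,n!)^{1/p}.$$ 3. For every $\lambda\in\mathbb C$ the series $\sum_{n\ge0}\lambda^nS_n(\phi)$ converges absolutely for each $\phi\in\mathcal C$, and both this series and the series of its absolute values converge uniformly in $\phi\in\mathcal C$. -/

import Mathlib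

open Real Set Filter Topology MeasureTheory
open scoped ENNReal ContDiff

namespace SMatrix2D

noncomputable section

/-- Points `(t, x)` of two-dimensional Minkowski space, with the measure `dt dx`. -/
abbrev Spacetime : Type := ℝ × ℝ

/-- The double cone `{(t, x) | -μ < t + x < μ, -μ < t - x < μ}`. -/
def doubleCone (μ : ℝ) : Set Spacetime :=
  {z | -μ < z.1 + z.2 ∧ z.1 + z.2 < μ ∧ -μ < z.1 - z.2 ∧ z.1 - z.2 < μ}

/-- Field configurations: smooth real functions on spacetime. -/
def Configurations : Set (Spacetime → ℝ) := {φ | ContDiff ℝ ∞ φ}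

/-- The relativistic energy `ω(k) = √(k² + m²)`. -/
def energy (m k : ℝ) : ℝ := √(k ^ 2 + m ^ 2)

/-- The plane wave `e^{i k x} e^{-i ω(k) t}`. -/
def planeWave (m k : ℝ) (z : Spacetime) : ℂ :=
  Complex.exp (Complex.I * ((k * z.2 - energy m k * z.1 : ℝ) : ℂ))

/-- The two-point function of the vacuum as a distribution:
`h ↦ (1 / 2π) ∫ dk (1 / 2ω(k)) ∫ dt dx h(t, x) e^{i k x - i ω(k) t}`. -/
def vacuumDistribution (m : ℝ) (h : Spacetime → ℂ) : ℂ :=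
  (1 / (2 * π) : ℝ) * ∫ k : ℝ, (1 / (2 * energy m k) : ℝ) * ∫ z : Spacetime, h z * planeWave m k z

/-- The kernel `Δ₊(t, x)` of the vacuum two-point function without cutoff, as the boundary value
`lim_{ε ↓ 0} (1 / 2π) ∫ dk (1 / 2ω(k)) e^{i k x - i ω(k) (t - i ε)}`. The limit exists off the
light cone `t² = x²`, which is a null set. -/
def twoPoint (m : ℝ) (z : Spacetime) : ℂ :=
  limUnder (𝓝[>] (0 : ℝ)) fun ε : ℝ =>
    ((1 / (2 * π) : ℝ) : ℂ) *
      ∫ k : ℝ, ((1 / (2 * energy m k) * Real.exp (-ε * energy m k) : ℝ) : ℂ) * planeWave m k z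

/-- `D` is a locally integrable function that represents the vacuum two-point distribution. -/
structure IsVacuumKernel (m : ℝ) (D : Spacetime → ℂ) : Prop where
  locallyIntegrable : LocallyIntegrable D volume
  pairing : ∀ h : Spacetime → ℂ, ContDiff ℝ ∞ h → HasCompactSupport h →
    ∫ z, D z * h z = vacuumDistribution m h

/-- The Feynman propagator `Δ_F(t, x) = θ(t) Δ₊(t, x) + θ(-t) Δ₊(-t, x)`. -/
def feynman (m : ℝ) (z : Spacetime) : ℂ :=
  if 0 ≤ z.1 then twoPoint m z else twoPoint m (-z.1, z.2)

/-- The integrand of the time-ordered product `V_{s₁}(g) ⋯ V_{sₙ}(g)` of vertex operators at `φ`: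
`∏ᵢ e^{i sᵢ φ(xᵢ)} · exp (- ∑_{l < j} s_l s_j Δ_F(x_l - x_j)) · ∏ᵢ g(xᵢ)`. -/
def vertexIntegrand (m : ℝ) (g : Spacetime → ℝ) (φ : Spacetime → ℝ) {n : ℕ}
    (s : Fin n → ℝ) (x : Fin n → Spacetime) : ℂ :=
  (∏ i, Complex.exp (Complex.I * ((s i * φ (x i) : ℝ) : ℂ))) *
    Complex.exp (-∑ l, ∑ j ∈ Finset.Ioi l,
      ((s l * s j : ℝ) : ℂ) * feynman m (x l - x j)) *
    ∏ i, ((g (x i) : ℝ) : ℂ)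

/-- The time-ordered product of the vertex operators `V_{s₁}(g), …, V_{sₙ}(g)`, at `φ`. -/
def timeOrderedVertex (m : ℝ) (g : Spacetime → ℝ) (φ : Spacetime → ℝ) {n : ℕ}
    (s : Fin n → ℝ) : ℂ :=
  ∫ x : Fin n → Spacetime, vertexIntegrand m g φ s x

/-- The `n`-fold time-ordered product of `L_I = ∫ ds f(s) V_s(g)` with itself, at `φ`. -/
def timeOrderedPower (m : ℝ) (f : ℝ → ℂ) (g : Spacetime → ℝ) (n : ℕ) (φ : Spacetime → ℝ) : ℂ :=
  ∫ s : Fin n → ℝ, (∏ i, f (s i)) * timeOrderedVertex m g φ s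

/-- The coefficient `Sₙ = (iⁿ / n!) T(L_I ⊗ ⋯ ⊗ L_I)` of the S-matrix, at `φ`. -/
def sCoeff (m : ℝ) (f : ℝ → ℂ) (g : Spacetime → ℝ) (n : ℕ) (φ : Spacetime → ℝ) : ℂ :=
  Complex.I ^ n / (n.factorial : ℂ) * timeOrderedPower m f g n φ

end

end SMatrix2D

namespace SMatrix2D

noncomputable section

/-! Time reversal conjugates `Δ₊`, so `Δ_F` and `Δ₊` have the same real part off the light cone. The
modulus of the interaction exponential is therefore the Boltzmann factor of a gas of charges `sᵢ`
whose pair potential `Re Δ₊` is positive definite. Its singularity is at most logarithmic, with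
coefficient `1/(4π)` in each of `u = t + x` and `v = t - x`.

Stability is an Onsager-type argument. Charge `i` is smeared with its own cutoffs `εᵢ` in `u` and
`δᵢ` in `v`. The smeared energy including self energies is nonnegative
(`sum_smoothedTwoPoint_nonneg`), so minus the smeared pair energy is at most half the self energies.
These are bounded by logarithms of the cutoffs (`re_smoothedTwoPoint_self_le`), while smearing
changes the potential of a pair by at most a constant times `ε/|u| + δ/|v|`
(`norm_twoPoint_sub_le`). With the inverse crowdings as cutoffs the errors add up to `O(n)`, and
`neg_energy_le` bounds the Boltzmann factor by `exp(cn)` times the product of the crowdings to the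
power `r²/(8π)`.

Raising this to the power `p < 4π/a²` leaves exponents at most `b/2` with `b < 1`. A crowding to the
power `b` is at most `n` times a factor from earlier points and a factor from later points.
Cauchy-Schwarz separates the two products, and in each the points are integrated out one at a time
against the integrable `|w|⁻ᵇ` (`lintegral_prod_crowding_le`). The result `(Cn)ⁿ` is of order `Cⁿ
n!`, and Hölder against the product of the `g(zᵢ)` gives `norm_sCoeff_le`. The field enters only
through phases, so all bounds are uniform in `φ`; for `p > 1` the surviving `(n!)^(1/p - 1)` makes
the Weierstrass test work for every `λ`.

For the vacuum kernel (`isVacuumKernel_twoPoint`), the cutoff functions have a locally integrable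
majorant of the type `1 + |u|^(-1/2) + |v|^(-1/2)`, uniform in the cutoff, so dominated convergence
removes the cutoff. -/

/-! ### The energy and integrals over momentum -/

lemma energy_pos {m : ℝ} (hm : 0 < m) (k : ℝ) : 0 < energy m k :=
  Real.sqrt_pos.2 (by positivity)

lemma energy_sq (m k : ℝ) : energy m k ^ 2 = k ^ 2 + m ^ 2 :=
  Real.sq_sqrt (by positivity)

lemma abs_le_energy (m k : ℝ) : |k| ≤ energy m k :=
  Real.abs_le_sqrt (by nlinarith [sq_nonneg m])

lemma energy_sub_nonneg (m k : ℝ) : 0 ≤ energy m k - k := by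
  linarith [le_abs_self k, abs_le_energy m k]

lemma energy_add_nonneg (m k : ℝ) : 0 ≤ energy m k + k := by
  linarith [neg_abs_le k, abs_le_energy m k]

lemma energy_neg (m k : ℝ) : energy m (-k) = energy m k := by simp [energy]

lemma continuous_energy (m : ℝ) : Continuous (energy m) := by
  unfold energy; fun_prop

lemma hasDerivAt_energy {m : ℝ} (hm : 0 < m) (k : ℝ) :
    HasDerivAt (energy m) (k / energy m k) k := by
  have h := ((hasDerivAt_pow 2 k).add_const (m ^ 2)).sqrt (by positivity)
  refine h.congr_deriv ?_
  have := (energy_pos hm k).ne'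
  simp only [energy] at this ⊢
  field_simp
  simp

lemma integrable_inv_energy_sq {m : ℝ} (hm : 0 < m) :
    Integrable fun k : ℝ => (energy m k ^ 2)⁻¹ := by
  have h := (integrable_inv_one_add_sq.comp_mul_left' (inv_ne_zero hm.ne')).const_mul ((m ^ 2)⁻¹)
  refine h.congr (Eventually.of_forall fun k => ?_)
  simp only [energy_sq]
  rw [← mul_inv]
  congr 1
  field_simp
  ring

lemma exp_neg_mul_energy_le {m : ℝ} (hm : 0 < m) {κ : ℝ} (hκ : 0 < κ) (k : ℝ) :
    Real.exp (-(κ * energy m k)) ≤ 2 / κ ^ 2 * (energy m k ^ 2)⁻¹ := by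
  have hω := energy_pos hm k
  have h := Real.quadratic_le_exp_of_nonneg (mul_pos hκ hω).le
  have hx := mul_pos hκ hω
  rw [Real.exp_neg, ← inv_inv (2 / κ ^ 2), ← mul_inv]
  apply inv_anti₀ (by positivity)
  rw [inv_div]
  calc κ ^ 2 / 2 * energy m k ^ 2 = (κ * energy m k) ^ 2 / 2 := by ring
    _ ≤ _ := by linarith

lemma integrable_exp_neg_mul_energy {m : ℝ} (hm : 0 < m) {κ : ℝ} (hκ : 0 < κ) :
    Integrable fun k : ℝ => Real.exp (-(κ * energy m k)) := by
  have hc := continuous_energy m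
  refine ((integrable_inv_energy_sq hm).const_mul (2 / κ ^ 2)).mono'
    (by fun_prop) (Eventually.of_forall fun k => ?_)
  rw [Real.norm_of_nonneg (Real.exp_pos _).le]
  exact exp_neg_mul_energy_le hm hκ k

/-! ### The two-point function in complex light-cone coordinates -/

/-- The mode function `exp (-(a (ω - k) + b (ω + k)) / 2)` at complex light-cone coordinates. -/
def lightConeMode (m : ℝ) (a b : ℂ) (k : ℝ) : ℂ :=
  Complex.exp (-(a * ((energy m k - k : ℝ) : ℂ) + b * ((energy m k + k : ℝ) : ℂ)) / 2)

/-- The two-point function continued to complex light-cone coordinates `a = ε + i (t + x)`,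
`b = ε' + i (t - x)` in the right half plane. -/
def smoothedTwoPoint (m : ℝ) (a b : ℂ) : ℂ :=
  ((1 / (4 * π) : ℝ) : ℂ) * ∫ k : ℝ, ((1 / energy m k : ℝ) : ℂ) * lightConeMode m a b k

lemma norm_lightConeMode (m : ℝ) (a b : ℂ) (k : ℝ) :
    ‖lightConeMode m a b k‖ =
      Real.exp (-(a.re * (energy m k - k) + b.re * (energy m k + k)) / 2) := by
  rw [lightConeMode, Complex.norm_exp]
  congr 1
  simp [-Complex.ofReal_sub, -Complex.ofReal_add]

lemma norm_lightConeMode_le (m : ℝ) {a b : ℂ} {κ : ℝ} (ha : κ ≤ a.re) (hb : κ ≤ b.re) (k : ℝ) :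
    ‖lightConeMode m a b k‖ ≤ Real.exp (-(κ * energy m k)) := by
  rw [norm_lightConeMode]
  apply Real.exp_le_exp.2
  nlinarith [mul_le_mul_of_nonneg_right ha (energy_sub_nonneg m k),
    mul_le_mul_of_nonneg_right hb (energy_add_nonneg m k)]

lemma norm_lightConeMode_le_one (m : ℝ) {a b : ℂ} (ha : 0 ≤ a.re) (hb : 0 ≤ b.re) (k : ℝ) :
    ‖lightConeMode m a b k‖ ≤ 1 := by
  simpa using norm_lightConeMode_le m ha hb k

lemma continuous_lightConeMode (m : ℝ) (a b : ℂ) : Continuous (lightConeMode m a b) := by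
  have := continuous_energy m
  unfold lightConeMode
  fun_prop

lemma integrable_lightConeMode {m : ℝ} (hm : 0 < m) {a b : ℂ} (ha : 0 < a.re) (hb : 0 < b.re) :
    Integrable (lightConeMode m a b) :=
  (integrable_exp_neg_mul_energy hm (lt_min ha hb)).mono'
    (continuous_lightConeMode m a b).aestronglyMeasurable
    (Eventually.of_forall fun k => norm_lightConeMode_le m (min_le_left _ _) (min_le_right _ _) k)

lemma continuous_inv_energy {m : ℝ} (hm : 0 < m) : Continuous fun k => 1 / energy m k :=
  continuous_const.div (continuous_energy m) fun k => (energy_pos hm k).ne'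

lemma one_div_energy_le {m : ℝ} (hm : 0 < m) (k : ℝ) : 1 / energy m k ≤ 1 / m := by
  apply one_div_le_one_div_of_le hm
  exact Real.le_sqrt_of_sq_le (by nlinarith [sq_nonneg k])

lemma integrable_inv_energy_mul_lightConeMode {m : ℝ} (hm : 0 < m) {a b : ℂ} (ha : 0 < a.re)
    (hb : 0 < b.re) :
    Integrable fun k => ((1 / energy m k : ℝ) : ℂ) * lightConeMode m a b k := by
  refine (integrable_lightConeMode hm ha hb).bdd_mul (c := 1 / m)
    (Complex.continuous_ofReal.comp (continuous_inv_energy hm)).aestronglyMeasurable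
    (Eventually.of_forall fun k => ?_)
  rw [Complex.norm_real, Real.norm_of_nonneg (one_div_nonneg.2 (energy_pos hm k).le)]
  exact one_div_energy_le hm k

lemma energy_sub_div_le {m : ℝ} (hm : 0 < m) (k : ℝ) :
    |(energy m k - k) / (2 * energy m k)| ≤ 1 := by
  have hω := energy_pos hm k
  rw [abs_of_nonneg (div_nonneg (energy_sub_nonneg m k) (by positivity)), div_le_one (by positivity)]
  linarith [energy_add_nonneg m k]

/-- The integrand of the logarithmic derivative of `smoothedTwoPoint`. -/
def lightConeFlux (m : ℝ) (a b : ℂ) (k : ℝ) : ℂ :=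
  (((energy m k - k) / (2 * energy m k) : ℝ) : ℂ) * lightConeMode m a b k

lemma continuous_lightConeFlux {m : ℝ} (hm : 0 < m) (a b : ℂ) :
    Continuous (lightConeFlux m a b) := by
  have h1 := continuous_energy m
  have h2 : Continuous fun k => (energy m k - k) / (2 * energy m k) :=
    Continuous.div (by fun_prop) (by fun_prop) fun k => by have := energy_pos hm k; positivity
  exact (Complex.continuous_ofReal.comp h2).mul (continuous_lightConeMode m a b)

lemma norm_lightConeFlux_le {m : ℝ} (hm : 0 < m) (a b : ℂ) (k : ℝ) :
    ‖lightConeFlux m a b k‖ ≤ ‖lightConeMode m a b k‖ := by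
  rw [lightConeFlux, norm_mul, Complex.norm_real]
  exact mul_le_of_le_one_left (norm_nonneg _) (energy_sub_div_le hm k)

lemma integrable_lightConeFlux {m : ℝ} (hm : 0 < m) {a b : ℂ} (ha : 0 < a.re) (hb : 0 < b.re) :
    Integrable (lightConeFlux m a b) :=
  (integrable_lightConeMode hm ha hb).mono (continuous_lightConeFlux hm a b).aestronglyMeasurable
    (Eventually.of_forall (norm_lightConeFlux_le hm a b))

lemma hasDerivAt_smoothedTwoPoint {m : ℝ} (hm : 0 < m) {a b : ℂ} (ha : 0 < a.re) (hb : 0 < b.re) :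
    HasDerivAt (fun a => smoothedTwoPoint m a b)
      (-(((1 / (4 * π) : ℝ) : ℂ) * ∫ k, lightConeFlux m a b k)) a := by
  have key : HasDerivAt (fun a => ∫ k : ℝ, ((1 / energy m k : ℝ) : ℂ) * lightConeMode m a b k)
      (∫ k, -lightConeFlux m a b k) a := by
    refine (hasDerivAt_integral_of_dominated_loc_of_deriv_le
      -- On this half plane the real part stays away from zero, so one decaying exponential
      -- dominates all derivatives.
      (s := {z : ℂ | a.re / 2 < z.re})
      (F := fun a k => ((1 / energy m k : ℝ) : ℂ) * lightConeMode m a b k)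
      (F' := fun a k => -lightConeFlux m a b k)
      (bound := fun k => Real.exp (-(min (a.re / 2) b.re * energy m k)))
      ?_ ?_ ?_ ?_ ?_ ?_ ?_).2
    · exact (isOpen_lt continuous_const Complex.continuous_re).mem_nhds (by simp [ha])
    · exact Eventually.of_forall fun z => ((Complex.continuous_ofReal.comp
        (continuous_inv_energy hm)).mul (continuous_lightConeMode m z b)).aestronglyMeasurable
    · exact integrable_inv_energy_mul_lightConeMode hm ha hb
    · exact (continuous_lightConeFlux hm a b).neg.aestronglyMeasurable
    · refine Eventually.of_forall fun k z hz => ?_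
      rw [norm_neg]
      exact (norm_lightConeFlux_le hm z b k).trans
        (norm_lightConeMode_le m ((min_le_left _ _).trans hz.le) (min_le_right _ _) k)
    · exact integrable_exp_neg_mul_energy hm (lt_min (by linarith) hb)
    · refine Eventually.of_forall fun k z _ => ?_
      have h1 : HasDerivAt (fun z : ℂ => -(z * ((energy m k - k : ℝ) : ℂ) +
          b * ((energy m k + k : ℝ) : ℂ)) / 2) (-((energy m k - k : ℝ) : ℂ) / 2) z := by
        have := ((((hasDerivAt_id z).mul_const ((energy m k - k : ℝ) : ℂ)).add_const
          (b * ((energy m k + k : ℝ) : ℂ))).neg).div_const 2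
        simpa using this
      refine (h1.cexp.const_mul ((1 / energy m k : ℝ) : ℂ)).congr_deriv ?_
      have hω : (energy m k : ℂ) ≠ 0 := Complex.ofReal_ne_zero.2 (energy_pos hm k).ne'
      rw [lightConeFlux, lightConeMode]
      push_cast
      field_simp
  rw [integral_neg] at key
  exact (key.const_mul _).congr_deriv (by ring)

/-- The reflection `k ↦ -k` exchanges `ω - k` and `ω + k`. Estimates in the first argument thereby
transfer to the second. -/
lemma smoothedTwoPoint_comm (m : ℝ) (a b : ℂ) :
    smoothedTwoPoint m a b = smoothedTwoPoint m b a := by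
  rw [smoothedTwoPoint, smoothedTwoPoint, ← integral_neg_eq_self]
  congr 2
  ext k
  rw [lightConeMode, lightConeMode, energy_neg]
  congr 3
  push_cast
  ring

lemma smoothedTwoPoint_conj (m : ℝ) (a b : ℂ) :
    smoothedTwoPoint m ((starRingEnd ℂ) a) ((starRingEnd ℂ) b) =
      (starRingEnd ℂ) (smoothedTwoPoint m a b) := by
  rw [smoothedTwoPoint, smoothedTwoPoint, map_mul, Complex.conj_ofReal, ← integral_conj]
  congr 2
  ext k
  rw [map_mul, Complex.conj_ofReal, lightConeMode, lightConeMode, ← Complex.exp_conj]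
  congr 2
  simp [-Complex.ofReal_sub, -Complex.ofReal_add, show (starRingEnd ℂ) 2 = 2 from map_ofNat _ 2]

/-! ### The logarithmic derivative, by integration by parts in momentum -/

/-- The constant `∫ m² / ω(k)² dk` (equal to `π m`). -/
def massConstant (m : ℝ) : ℝ := ∫ k, m ^ 2 / energy m k ^ 2

lemma massConstant_nonneg (m : ℝ) : 0 ≤ massConstant m :=
  integral_nonneg fun k => by positivity

lemma integrable_massConstant {m : ℝ} (hm : 0 < m) :
    Integrable fun k => m ^ 2 / energy m k ^ 2 :=
  (integrable_inv_energy_sq hm).const_mul (m ^ 2)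

lemma setIntegral_massConstant_le {m : ℝ} (hm : 0 < m) (s : Set ℝ) :
    ∫ k in s, m ^ 2 / energy m k ^ 2 ≤ massConstant m :=
  setIntegral_le_integral (integrable_massConstant hm)
    (Eventually.of_forall fun k => by simp only [Pi.zero_apply]; positivity)

/-- For `k ≥ 0` one has `(ω - k) ω ≤ (ω - k)(ω + k) = m²`. On this half line the flux is integrable
without any decay of the mode. -/
lemma energy_sub_div_le_of_nonneg {m : ℝ} (hm : 0 < m) {k : ℝ} (hk : 0 ≤ k) :
    |(energy m k - k) / (2 * energy m k)| ≤ (m ^ 2 / energy m k ^ 2) / 2 := by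
  have hω := energy_pos hm k
  have h2 := energy_sq m k
  rw [abs_of_nonneg (div_nonneg (energy_sub_nonneg m k) (by positivity)), div_div,
    div_le_div_iff₀ (by positivity) (by positivity)]
  have : (energy m k - k) * energy m k ≤ m ^ 2 := by nlinarith [energy_sub_nonneg m k]
  nlinarith

/-- This total derivative trades `a` times the flux at `k` for `b` times the reflected flux at `-k`,
which is harmless exactly where the first one is not, at negative `k`. -/
lemma hasDerivAt_lightConeMode {m : ℝ} (hm : 0 < m) (a b : ℂ) (k : ℝ) :
    HasDerivAt (lightConeMode m a b)
      (a * lightConeFlux m a b k - b * lightConeFlux m b a (-k)) k := by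
  have h1 := hasDerivAt_energy hm k
  have h2 : HasDerivAt (fun k => energy m k - k) (k / energy m k - 1) k := h1.sub (hasDerivAt_id k)
  have h3 : HasDerivAt (fun k => energy m k + k) (k / energy m k + 1) k := h1.add (hasDerivAt_id k)
  have h4 := ((((h2.ofReal_comp).const_mul a).add ((h3.ofReal_comp).const_mul b)).neg.div_const
    2).cexp
  refine h4.congr_deriv ?_
  have hω : (energy m k : ℂ) ≠ 0 := Complex.ofReal_ne_zero.2 (energy_pos hm k).ne'
  have e : lightConeMode m b a (-k) = lightConeMode m a b k := by
    rw [lightConeMode, lightConeMode, energy_neg]; congr 3; push_cast; ring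
  rw [lightConeFlux, lightConeFlux, e, energy_neg]
  change lightConeMode m a b k * _ = _
  push_cast
  field_simp
  ring

lemma tendsto_lightConeMode_atBot {m : ℝ} {a b : ℂ} (ha : 0 < a.re) (hb : 0 < b.re) :
    Tendsto (lightConeMode m a b) atBot (𝓝 0) := by
  rw [tendsto_zero_iff_norm_tendsto_zero]
  have hκ := lt_min ha hb
  refine squeeze_zero (fun _ => norm_nonneg _)
    (g := fun k => Real.exp (min a.re b.re * k)) (fun k => ?_) ?_
  · refine (norm_lightConeMode_le m (min_le_left _ _) (min_le_right _ _) k).trans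
      (Real.exp_le_exp.2 ?_)
    nlinarith [energy_add_nonneg m k]
  · exact Real.tendsto_exp_atBot.comp (tendsto_id.const_mul_atBot hκ)

lemma norm_lightConeFlux_le_of_nonneg {m : ℝ} (hm : 0 < m) {a b : ℂ} (ha : 0 ≤ a.re)
    (hb : 0 ≤ b.re) {k : ℝ} (hk : 0 ≤ k) :
    ‖lightConeFlux m a b k‖ ≤ (m ^ 2 / energy m k ^ 2) / 2 := by
  rw [lightConeFlux, norm_mul, Complex.norm_real]
  exact (mul_le_of_le_one_right (abs_nonneg _) (norm_lightConeMode_le_one m ha hb k)).trans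
    (energy_sub_div_le_of_nonneg hm hk)

lemma norm_setIntegral_Ioi_lightConeFlux_le {m : ℝ} (hm : 0 < m) {a b : ℂ} (ha : 0 < a.re)
    (hb : 0 < b.re) : ‖∫ k in Ioi 0, lightConeFlux m a b k‖ ≤ massConstant m / 2 := by
  refine (norm_integral_le_of_norm_le
    (((integrable_massConstant hm).div_const 2).integrableOn (s := Ioi 0)) ?_).trans ?_
  · exact (ae_restrict_iff' measurableSet_Ioi).2 (Eventually.of_forall fun k hk =>
      norm_lightConeFlux_le_of_nonneg hm ha.le hb.le (mem_Ioi.1 hk).le)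
  · rw [integral_div]
    linarith [setIntegral_massConstant_le hm (Ioi 0)]

lemma norm_setIntegral_Iic_lightConeFlux_neg_le {m : ℝ} (hm : 0 < m) {a b : ℂ} (ha : 0 < a.re)
    (hb : 0 < b.re) : ‖∫ k in Iic 0, lightConeFlux m b a (-k)‖ ≤ massConstant m / 2 := by
  refine (norm_integral_le_of_norm_le
    (((integrable_massConstant hm).div_const 2).integrableOn (s := Iic 0)) ?_).trans ?_
  · refine (ae_restrict_iff' measurableSet_Iic).2 (Eventually.of_forall fun k hk => ?_)
    have := norm_lightConeFlux_le_of_nonneg hm hb.le ha.le (neg_nonneg.2 (mem_Iic.1 hk))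
    rwa [energy_neg] at this
  · rw [integral_div]
    linarith [setIntegral_massConstant_le hm (Iic 0)]

lemma setIntegral_Iic_lightConeFlux {m : ℝ} (hm : 0 < m) {a b : ℂ} (ha : 0 < a.re)
    (hb : 0 < b.re) :
    a * ∫ k in Iic 0, lightConeFlux m a b k =
      lightConeMode m a b 0 + b * ∫ k in Iic 0, lightConeFlux m b a (-k) := by
  have i1 : IntegrableOn (lightConeFlux m a b) (Iic 0) :=
    (integrable_lightConeFlux hm ha hb).integrableOn
  have i2 : IntegrableOn (fun k => lightConeFlux m b a (-k)) (Iic 0) :=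
    (integrable_lightConeFlux hm hb ha).comp_neg.integrableOn
  have h := integral_Iic_of_hasDerivAt_of_tendsto' (a := 0) (f := lightConeMode m a b)
    (fun k _ => hasDerivAt_lightConeMode hm a b k)
    ((i1.const_mul a).sub (i2.const_mul b)) (tendsto_lightConeMode_atBot ha hb)
  rw [integral_sub (i1.const_mul a) (i2.const_mul b), integral_const_mul, integral_const_mul] at h
  linear_combination h

/-- Positive momenta contribute `|a|` times half the mass constant; negative ones, after integration
by parts, a boundary term of modulus at most one and `|b|` times the same constant. The derivative
in `a` is thus `O(1/|a|)`, a logarithmic singularity at worst. -/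
lemma norm_mul_integral_lightConeFlux_le {m : ℝ} (hm : 0 < m) {a b : ℂ} (ha : 0 < a.re)
    (hb : 0 < b.re) :
    ‖a‖ * ‖∫ k, lightConeFlux m a b k‖ ≤ 1 + (‖a‖ + ‖b‖) * (massConstant m / 2) := by
  have i1 := integrable_lightConeFlux hm ha hb
  rw [← norm_mul, ← integral_add_compl (measurableSet_Iic (a := (0 : ℝ))) i1, compl_Iic, mul_add,
    setIntegral_Iic_lightConeFlux hm ha hb]
  have h1 := norm_setIntegral_Ioi_lightConeFlux_le hm ha hb
  have h2 := norm_setIntegral_Iic_lightConeFlux_neg_le hm ha hb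
  have h3 := norm_lightConeMode_le_one m ha.le hb.le 0
  refine (norm_add₃_le).trans ?_
  rw [norm_mul, norm_mul]
  nlinarith [mul_le_mul_of_nonneg_left h1 (norm_nonneg a),
    mul_le_mul_of_nonneg_left h2 (norm_nonneg b)]

/-- Lipschitz constant of `smoothedTwoPoint` in the logarithm of its arguments. -/
def lipConstant (m R : ℝ) : ℝ := 1 / (4 * π) * (1 + R * (massConstant m / 2))

lemma lipConstant_nonneg (m : ℝ) {R : ℝ} (hR : 0 ≤ R) : 0 ≤ lipConstant m R := by
  have := massConstant_nonneg m
  unfold lipConstant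
  positivity

lemma norm_deriv_smoothedTwoPoint_le {m : ℝ} (hm : 0 < m) {a b : ℂ} (ha : 0 < a.re)
    (hb : 0 < b.re) {R : ℝ} (hR : ‖a‖ + ‖b‖ ≤ R) :
    ‖-(((1 / (4 * π) : ℝ) : ℂ) * ∫ k, lightConeFlux m a b k)‖ ≤ lipConstant m R / ‖a‖ := by
  have hna : 0 < ‖a‖ := norm_pos_iff.2 fun h => by simp [h] at ha
  have h := norm_mul_integral_lightConeFlux_le hm ha hb
  have hM := massConstant_nonneg m
  rw [norm_neg, norm_mul, Complex.norm_real, Real.norm_of_nonneg (by positivity), lipConstant,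
    mul_div_assoc]
  apply mul_le_mul_of_nonneg_left _ (by positivity)
  rw [le_div_iff₀ hna]
  nlinarith

/-- Mean value inequality in the cutoff: along the segment the argument has modulus at least `|u|`,
so the derivative is at most `lipConstant m R / |u|`. -/
lemma norm_smoothedTwoPoint_sub_le {m : ℝ} (hm : 0 < m) {u ε₁ ε₂ ρ R : ℝ} {b : ℂ} (hu : u ≠ 0)
    (h1 : 0 < ε₁) (h2 : 0 < ε₂) (h1' : ε₁ ≤ ρ) (h2' : ε₂ ≤ ρ) (hb : 0 < b.re)
    (hR : ρ + |u| + ‖b‖ ≤ R) :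
    ‖smoothedTwoPoint m (ε₁ + u * Complex.I) b - smoothedTwoPoint m (ε₂ + u * Complex.I) b‖ ≤
      lipConstant m R / |u| * |ε₁ - ε₂| := by
  have hR0 : 0 ≤ R := by
    have := abs_nonneg u; have := norm_nonneg b; linarith
  have hder : ∀ ε ∈ Ioc 0 ρ, HasDerivWithinAt
      (fun ε : ℝ => smoothedTwoPoint m (ε + u * Complex.I) b)
      (-(((1 / (4 * π) : ℝ) : ℂ) * ∫ k, lightConeFlux m (ε + u * Complex.I) b k)) (Ioc 0 ρ) ε := by
    intro ε hε
    have hre : 0 < ((ε : ℂ) + u * Complex.I).re := by simpa using hε.1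
    have h : HasDerivAt (fun ε : ℝ => (ε : ℂ) + u * Complex.I) 1 ε :=
      ((hasDerivAt_id (ε : ℂ)).comp_ofReal).add_const _
    exact (((hasDerivAt_smoothedTwoPoint hm hre hb).scomp ε h).congr_deriv
      (one_smul _ _)).hasDerivWithinAt
  have hbd : ∀ ε ∈ Ioc 0 ρ,
      ‖-(((1 / (4 * π) : ℝ) : ℂ) * ∫ k, lightConeFlux m (ε + u * Complex.I) b k)‖ ≤
        lipConstant m R / |u| := by
    intro ε hε
    have hre : 0 < ((ε : ℂ) + u * Complex.I).re := by simpa using hε.1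
    have hle : ‖(ε : ℂ) + u * Complex.I‖ ≤ ρ + |u| := by
      refine (norm_add_le _ _).trans ?_
      simp only [Complex.norm_real, norm_mul, Complex.norm_I, mul_one, Real.norm_eq_abs]
      rw [abs_of_pos hε.1]
      linarith [hε.2]
    have hge : |u| ≤ ‖(ε : ℂ) + u * Complex.I‖ := by
      simpa using Complex.abs_im_le_norm ((ε : ℂ) + u * Complex.I)
    refine (norm_deriv_smoothedTwoPoint_le hm hre hb (R := R) (by linarith)).trans ?_
    exact div_le_div_of_nonneg_left (lipConstant_nonneg m hR0) (abs_pos.2 hu) hge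
  have := (convex_Ioc 0 ρ).norm_image_sub_le_of_norm_hasDerivWithin_le hder hbd
    ⟨h2, h2'⟩ ⟨h1, h1'⟩
  simpa using this

/-! ### Positivity of the smeared energy -/

lemma lightConeMode_add_conj (m : ℝ) (a b c d : ℂ) (k : ℝ) :
    lightConeMode m (a + (starRingEnd ℂ) c) (b + (starRingEnd ℂ) d) k =
      lightConeMode m a b k * (starRingEnd ℂ) (lightConeMode m c d k) := by
  rw [lightConeMode, lightConeMode, lightConeMode, ← Complex.exp_conj, ← Complex.exp_add]
  congr 1
  simp only [map_div₀, map_neg, map_add, map_mul, Complex.conj_ofReal,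
    show (starRingEnd ℂ) 2 = 2 from map_ofNat _ 2]
  ring

/-- Modes are multiplicative in their arguments, so the double sum is the integral of `|∑ sᵢ
modeᵢ(k)|² / ω(k)`: a Gram form. -/
theorem sum_smoothedTwoPoint_nonneg {m : ℝ} (hm : 0 < m) {ι : Type*} [Fintype ι] (s : ι → ℝ)
    (a b : ι → ℂ) (ha : ∀ i, 0 < (a i).re) (hb : ∀ i, 0 < (b i).re) :
    0 ≤ ∑ i, ∑ j, s i * s j * (smoothedTwoPoint m (a i + (starRingEnd ℂ) (a j))
      (b i + (starRingEnd ℂ) (b j))).re := by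
  have hint : ∀ i j, Integrable fun k => ((1 / energy m k : ℝ) : ℂ) *
      lightConeMode m (a i + (starRingEnd ℂ) (a j)) (b i + (starRingEnd ℂ) (b j)) k := by
    intro i j
    refine integrable_inv_energy_mul_lightConeMode hm ?_ ?_
    · simpa using add_pos (ha i) (ha j)
    · simpa using add_pos (hb i) (hb j)
  have key : ∑ i, ∑ j, ((s i * s j : ℝ) : ℂ) * smoothedTwoPoint m (a i + (starRingEnd ℂ) (a j))
      (b i + (starRingEnd ℂ) (b j)) = ((1 / (4 * π) * ∫ k, 1 / energy m k *
        Complex.normSq (∑ i, s i * lightConeMode m (a i) (b i) k) : ℝ) : ℂ) := by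
    simp only [smoothedTwoPoint]
    rw [Complex.ofReal_mul, ← integral_complex_ofReal]
    have : ∀ i j, ((s i * s j : ℝ) : ℂ) * (((1 / (4 * π) : ℝ) : ℂ) * ∫ k : ℝ,
        ((1 / energy m k : ℝ) : ℂ) * lightConeMode m (a i + (starRingEnd ℂ) (a j))
        (b i + (starRingEnd ℂ) (b j)) k) = ((1 / (4 * π) : ℝ) : ℂ) * ∫ k : ℝ,
          ((s i * s j : ℝ) : ℂ) * (((1 / energy m k : ℝ) : ℂ) *
            lightConeMode m (a i + (starRingEnd ℂ) (a j)) (b i + (starRingEnd ℂ) (b j)) k) := by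
      intro i j
      rw [integral_const_mul]; ring
    simp only [this, ← Finset.mul_sum]
    congr 1
    rw [← Finset.sum_congr rfl fun i _ => integral_finsetSum Finset.univ
      fun j _ => (hint i j).const_mul ((s i * s j : ℝ) : ℂ), ← integral_finsetSum _
      fun i _ => integrable_finsetSum _ fun j _ => (hint i j).const_mul ((s i * s j : ℝ) : ℂ)]
    congr 1
    ext k
    rw [Complex.ofReal_mul, Complex.normSq_eq_conj_mul_self, map_sum, Finset.sum_mul_sum,
      Finset.sum_comm, Finset.mul_sum]
    refine Finset.sum_congr rfl fun i _ => ?_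
    rw [Finset.mul_sum]
    refine Finset.sum_congr rfl fun j _ => ?_
    rw [lightConeMode_add_conj, map_mul, Complex.conj_ofReal]
    push_cast
    ring
  have h2 := congrArg Complex.re key
  rw [Complex.ofReal_re, Complex.re_sum] at h2
  simp only [Complex.re_sum, Complex.re_ofReal_mul] at h2
  rw [h2]
  refine mul_nonneg (by positivity) (integral_nonneg fun k => ?_)
  exact mul_nonneg (one_div_nonneg.2 (energy_pos hm k).le) (Complex.normSq_nonneg _)

/-! ### Self energies with the sharp logarithmic coefficient -/

lemma lightConeFlux_ofReal (m a b k : ℝ) (hm : 0 < m) :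
    lightConeFlux m a b k = (‖lightConeFlux m a b k‖ : ℝ) := by
  have h1 : 0 ≤ (energy m k - k) / (2 * energy m k) :=
    div_nonneg (energy_sub_nonneg m k) (by linarith [energy_pos hm k])
  rw [lightConeFlux, norm_mul, Complex.norm_real, Real.norm_of_nonneg h1, norm_lightConeMode,
    lightConeMode]
  push_cast
  rfl

lemma norm_lightConeFlux_anti {m : ℝ} {a b b' : ℝ} (h : b' ≤ b) (k : ℝ) :
    ‖lightConeFlux m a b k‖ ≤ ‖lightConeFlux m a b' k‖ := by
  rw [lightConeFlux, lightConeFlux, norm_mul, norm_mul, norm_lightConeMode, norm_lightConeMode]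
  apply mul_le_mul_of_nonneg_left _ (norm_nonneg _)
  apply Real.exp_le_exp.2
  simp only [Complex.ofReal_re]
  nlinarith [energy_add_nonneg m k]

/-- The flux decreases in `b`, so `b` may be replaced by any smaller `b'`, and `b' → 0` removes the
error `b' * massConstant m / 2`. The exact constant 1 matters: it becomes the coefficient of the
logarithm in the self energy, hence the threshold `4π`. -/
lemma mul_setIntegral_Iic_norm_lightConeFlux_le {m : ℝ} (hm : 0 < m) {a b : ℝ} (ha : 0 < a)
    (hb : 0 < b) : a * ∫ k in Iic 0, ‖lightConeFlux m a b k‖ ≤ 1 := by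
  have hM := massConstant_nonneg m
  have step : ∀ b' ∈ Ioc 0 b, a * ∫ k in Iic 0, ‖lightConeFlux m a b k‖ ≤
      1 + b' * (massConstant m / 2) := by
    intro b' hb'
    have ha' : 0 < (a : ℂ).re := by simpa using ha
    have hb'' : 0 < (b' : ℂ).re := by simpa using hb'.1
    have e := setIntegral_Iic_lightConeFlux hm ha' hb''
    have h1 : ∫ k in Iic 0, lightConeFlux m a b' k =
        ((∫ k in Iic 0, ‖lightConeFlux m a b' k‖ : ℝ) : ℂ) := by
      rw [← integral_complex_ofReal]
      exact integral_congr_ae (Eventually.of_forall fun k => lightConeFlux_ofReal m a b' k hm)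
    rw [h1] at e
    have h2 := congrArg norm e
    rw [norm_mul, Complex.norm_real, Complex.norm_real, Real.norm_of_nonneg ha.le,
      Real.norm_of_nonneg (integral_nonneg fun _ => norm_nonneg _)] at h2
    have h3 : ‖lightConeMode m a b' 0 + b' * ∫ k in Iic 0, lightConeFlux m b' a (-k)‖ ≤
        1 + b' * (massConstant m / 2) := by
      refine (norm_add_le _ _).trans (add_le_add
        (norm_lightConeMode_le_one m ha'.le hb''.le 0) ?_)
      rw [norm_mul, Complex.norm_real, Real.norm_of_nonneg hb'.1.le]
      exact mul_le_mul_of_nonneg_left (norm_setIntegral_Iic_lightConeFlux_neg_le hm ha' hb'')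
        hb'.1.le
    refine le_trans (mul_le_mul_of_nonneg_left ?_ ha.le) (h2.trans_le h3)
    refine setIntegral_mono (integrable_lightConeFlux hm ha' (by simpa using hb)).norm.integrableOn
      (integrable_lightConeFlux hm ha' hb'').norm.integrableOn
      fun k => norm_lightConeFlux_anti hb'.2 k
  refine ge_of_tendsto (x := 𝓝[>] (0 : ℝ)) (f := fun b' : ℝ => 1 + b' * (massConstant m / 2)) ?_
    (by filter_upwards [Ioc_mem_nhdsGT hb] with b' hb' using step b' hb')
  have : Continuous fun b' : ℝ => 1 + b' * (massConstant m / 2) := by fun_prop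
  simpa using (this.tendsto 0).mono_left nhdsWithin_le_nhds

lemma mul_re_integral_lightConeFlux_le {m : ℝ} (hm : 0 < m) {a b : ℝ} (ha : 0 < a)
    (hb : 0 < b) : a * (∫ k, lightConeFlux m a b k).re ≤ 1 + a * (massConstant m / 2) := by
  have ha' : 0 < (a : ℂ).re := by simpa using ha
  have hb' : 0 < (b : ℂ).re := by simpa using hb
  rw [← integral_add_compl (measurableSet_Iic (a := (0 : ℝ))) (integrable_lightConeFlux hm ha' hb'),
    compl_Iic, Complex.add_re, mul_add]
  apply add_le_add
  · refine le_trans (mul_le_mul_of_nonneg_left ?_ ha.le)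
      (mul_setIntegral_Iic_norm_lightConeFlux_le hm ha hb)
    exact (Complex.re_le_norm _).trans (norm_integral_le_integral_norm _)
  · exact mul_le_mul_of_nonneg_left ((Complex.re_le_norm _).trans
      (norm_setIntegral_Ioi_lightConeFlux_le hm ha' hb')) ha.le

lemma re_smoothedTwoPoint_le_log {m : ℝ} (hm : 0 < m) {ε b : ℝ} (hε : 0 < ε) (hε1 : ε ≤ 1)
    (hb : 0 < b) :
    (smoothedTwoPoint m ((2 * ε : ℝ) : ℂ) b).re ≤ (smoothedTwoPoint m (2 : ℝ) b).re +
      1 / (4 * π) * (-Real.log ε + massConstant m) := by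
  have hb' : 0 < (b : ℂ).re := by simpa using hb
  have hM := massConstant_nonneg m
  -- The derivative bound says that adding this logarithm and linear term makes the function
  -- increasing; comparing `2 * ε` with `2` gives the claim.
  set h : ℝ → ℝ := fun x => (smoothedTwoPoint m (x : ℂ) b).re +
    1 / (4 * π) * (Real.log x + x * (massConstant m / 2)) with hdef
  have hder : ∀ x ∈ Ioi (0 : ℝ), HasDerivAt h (-(1 / (4 * π)) * (∫ k, lightConeFlux m x b k).re +
      1 / (4 * π) * (x⁻¹ + massConstant m / 2)) x := by
    intro x hx
    have h1 := (hasDerivAt_smoothedTwoPoint hm (a := (x : ℂ)) (by simpa using hx) hb').real_of_complex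
    have h2 := (((Real.hasDerivAt_log (ne_of_gt hx)).add
      ((hasDerivAt_id x).mul_const (massConstant m / 2))).const_mul (1 / (4 * π)))
    refine (h1.add h2).congr_deriv ?_
    rw [Complex.neg_re, Complex.re_ofReal_mul]
    ring
  have hmono : MonotoneOn h (Ioi 0) := by
    refine monotoneOn_of_hasDerivWithinAt_nonneg (convex_Ioi 0)
      (fun x hx => (hder x hx).continuousAt.continuousWithinAt)
      (fun x hx => (hder x (interior_subset hx)).hasDerivWithinAt) ?_
    intro x hx
    have hx0 : 0 < x := interior_subset hx
    have h1 := mul_re_integral_lightConeFlux_le hm hx0 hb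
    have h2 : (∫ k, lightConeFlux m x b k).re ≤ x⁻¹ + massConstant m / 2 := by
      rw [← mul_le_mul_iff_right₀ hx0]
      refine h1.trans_eq ?_
      field_simp
    have h3 : 0 < 1 / (4 * π) := by positivity
    nlinarith
  have := hmono (mem_Ioi.2 (by linarith : 0 < 2 * ε)) (mem_Ioi.2 (by norm_num : (0:ℝ) < 2))
    (by linarith)
  simp only [hdef] at this
  rw [Real.log_mul two_ne_zero hε.ne'] at this
  have h3 : 0 < 1 / (4 * π) := by positivity
  have h4 := mul_nonneg h3.le (mul_nonneg hε.le hM)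
  nlinarith

/-- A constant that bounds the renormalized self energy of a smeared charge. -/
def selfEnergyConstant (m : ℝ) : ℝ :=
  |(smoothedTwoPoint m (2 : ℝ) (2 : ℝ)).re| + 1 / (2 * π) * massConstant m

lemma selfEnergyConstant_nonneg (m : ℝ) : 0 ≤ selfEnergyConstant m := by
  have := massConstant_nonneg m
  unfold selfEnergyConstant
  positivity

/-- Each argument in turn is moved to the reference value 2, at the price of one logarithm. The
arguments are doubled because on the diagonal a cutoff is added to itself. -/
theorem re_smoothedTwoPoint_self_le {m : ℝ} (hm : 0 < m) {ε δ : ℝ} (hε : 0 < ε) (hε1 : ε ≤ 1)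
    (hδ : 0 < δ) (hδ1 : δ ≤ 1) :
    (smoothedTwoPoint m ((2 * ε : ℝ) : ℂ) ((2 * δ : ℝ) : ℂ)).re ≤
      1 / (4 * π) * (-Real.log ε + -Real.log δ) + selfEnergyConstant m := by
  have h1 := re_smoothedTwoPoint_le_log hm hε hε1 (b := 2 * δ) (by linarith)
  have h2 := re_smoothedTwoPoint_le_log hm hδ hδ1 (b := 2) (by norm_num)
  rw [smoothedTwoPoint_comm] at h2
  have h3 := le_abs_self (smoothedTwoPoint m (2 : ℝ) (2 : ℝ)).re
  have e : 1 / (2 * π) = 1 / (4 * π) + 1 / (4 * π) := by field_simp; norm_num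
  rw [selfEnergyConstant, e]
  linarith

lemma norm_add_mul_I_le {ε u L : ℝ} (h0 : 0 < ε) (h1 : ε ≤ 2) (hu : |u| ≤ L) :
    ‖(ε : ℂ) + u * Complex.I‖ ≤ 2 + L := by
  refine (norm_add_le _ _).trans ?_
  simp only [Complex.norm_real, norm_mul, Complex.norm_I, mul_one, Real.norm_eq_abs]
  rw [abs_of_pos h0]
  linarith

/-- The two cutoffs are changed one after the other. They must be independent, since crowding in `u`
and in `v` is unrelated. -/
lemma norm_smoothedTwoPoint_sub_le₂ {m : ℝ} (hm : 0 < m) {u v ε₁ ε₂ δ₁ δ₂ L : ℝ} (hu : u ≠ 0)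
    (hv : v ≠ 0) (huL : |u| ≤ L) (hvL : |v| ≤ L) (hε₁ : ε₁ ∈ Ioc 0 2) (hε₂ : ε₂ ∈ Ioc 0 2)
    (hδ₁ : δ₁ ∈ Ioc 0 2) (hδ₂ : δ₂ ∈ Ioc 0 2) :
    ‖smoothedTwoPoint m (ε₁ + u * Complex.I) (δ₁ + v * Complex.I) -
        smoothedTwoPoint m (ε₂ + u * Complex.I) (δ₂ + v * Complex.I)‖ ≤
      lipConstant m (4 + 2 * L) * (|ε₁ - ε₂| / |u| + |δ₁ - δ₂| / |v|) := by
  have h1 := norm_smoothedTwoPoint_sub_le hm hu hε₁.1 hε₂.1 hε₁.2 hε₂.2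
    (b := δ₁ + v * Complex.I) (R := 4 + 2 * L) (by simpa using hδ₁.1)
    (by linarith [norm_add_mul_I_le hδ₁.1 hδ₁.2 hvL])
  have h2 := norm_smoothedTwoPoint_sub_le hm hv hδ₁.1 hδ₂.1 hδ₁.2 hδ₂.2
    (b := ε₂ + u * Complex.I) (R := 4 + 2 * L) (by simpa using hε₂.1)
    (by linarith [norm_add_mul_I_le hε₂.1 hε₂.2 huL])
  rw [smoothedTwoPoint_comm m _ (ε₂ + u * Complex.I),
    smoothedTwoPoint_comm m _ (ε₂ + u * Complex.I)] at h2
  refine (norm_sub_le_norm_sub_add_norm_sub _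
    (smoothedTwoPoint m (ε₂ + u * Complex.I) (δ₁ + v * Complex.I)) _).trans
    ((add_le_add h1 h2).trans_eq ?_)
  ring

/-! ### Removal of the cutoff and the Feynman propagator -/

/-- The two-point function with ultraviolet cutoff `ε`. -/
def cutoffTwoPoint (m ε : ℝ) (z : Spacetime) : ℂ :=
  smoothedTwoPoint m (ε + (z.1 + z.2 : ℝ) * Complex.I) (ε + (z.1 - z.2 : ℝ) * Complex.I)

lemma lightConeMode_eq_planeWave (m ε k : ℝ) (z : Spacetime) :
    lightConeMode m (ε + (z.1 + z.2 : ℝ) * Complex.I) (ε + (z.1 - z.2 : ℝ) * Complex.I) k =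
      (Real.exp (-ε * energy m k) : ℝ) * planeWave m k z := by
  rw [lightConeMode, planeWave, Complex.ofReal_exp, ← Complex.exp_add]
  congr 1
  push_cast
  ring

lemma cutoffTwoPoint_eq (m ε : ℝ) (z : Spacetime) :
    cutoffTwoPoint m ε z = ((1 / (2 * π) : ℝ) : ℂ) *
      ∫ k : ℝ, ((1 / (2 * energy m k) * Real.exp (-ε * energy m k) : ℝ) : ℂ) * planeWave m k z := by
  rw [cutoffTwoPoint, smoothedTwoPoint]
  simp only [lightConeMode_eq_planeWave]
  have : ∀ k, ((1 / (2 * energy m k) * Real.exp (-ε * energy m k) : ℝ) : ℂ) * planeWave m k z =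
      (1 / 2 : ℂ) * (((1 / energy m k : ℝ) : ℂ) * ((Real.exp (-ε * energy m k) : ℝ) *
        planeWave m k z)) := by
    intro k
    push_cast
    ring
  simp only [this]
  rw [integral_const_mul, ← mul_assoc]
  congr 1
  push_cast
  ring

lemma twoPoint_eq_limUnder (m : ℝ) (z : Spacetime) :
    twoPoint m z = limUnder (𝓝[>] (0 : ℝ)) fun ε => cutoffTwoPoint m ε z := by
  simp only [twoPoint, cutoffTwoPoint_eq]

/-- Off the light cone the cutoff function is Lipschitz in `ε` up to `ε = 0`, hence Cauchy; this
gives `limUnder` its meaning. -/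
theorem tendsto_cutoffTwoPoint {m : ℝ} (hm : 0 < m) {z : Spacetime} (hu : z.1 + z.2 ≠ 0)
    (hv : z.1 - z.2 ≠ 0) :
    Tendsto (fun ε => cutoffTwoPoint m ε z) (𝓝[>] 0) (𝓝 (twoPoint m z)) := by
  rw [twoPoint_eq_limUnder]
  apply tendsto_nhds_limUnder
  set L := max |z.1 + z.2| |z.1 - z.2|
  have hL : 0 ≤ L := (abs_nonneg _).trans (le_max_left _ _)
  set D := lipConstant m (4 + 2 * L) * (1 / |z.1 + z.2| + 1 / |z.1 - z.2|)
  have hD : 0 ≤ D := mul_nonneg (lipConstant_nonneg m (by linarith)) (by positivity)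
  have hlip : ∀ ε₁ ∈ Ioc (0 : ℝ) 2, ∀ ε₂ ∈ Ioc (0 : ℝ) 2,
      dist (cutoffTwoPoint m ε₁ z) (cutoffTwoPoint m ε₂ z) ≤ D * |ε₁ - ε₂| := by
    intro ε₁ h1 ε₂ h2
    rw [dist_eq_norm]
    refine (norm_smoothedTwoPoint_sub_le₂ hm hu hv (le_max_left _ _) (le_max_right _ _)
      h1 h2 h1 h2).trans_eq ?_
    ring
  have hc : Cauchy (map (fun ε => cutoffTwoPoint m ε z) (𝓝[>] 0)) := by
    rw [Metric.cauchy_iff]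
    refine ⟨inferInstance, fun η hη => ?_⟩
    have hr : 0 < min 2 (η / (D + 1)) := lt_min two_pos (by positivity)
    refine ⟨_, image_mem_map (Ioo_mem_nhdsGT hr), ?_⟩
    rintro _ ⟨x, hx, rfl⟩ _ ⟨y, hy, rfl⟩
    have hx2 := hx.2.trans_le (min_le_left _ _)
    have hy2 := hy.2.trans_le (min_le_left _ _)
    refine (hlip x ⟨hx.1, hx2.le⟩ y ⟨hy.1, hy2.le⟩).trans_lt ?_
    have hxy : |x - y| < η / (D + 1) := by
      rw [abs_lt]
      have h1 := hx.2.trans_le (min_le_right _ _)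
      have h2 := hy.2.trans_le (min_le_right _ _)
      constructor <;> linarith [hx.1, hy.1]
    rw [lt_div_iff₀ (by positivity)] at hxy
    nlinarith [abs_nonneg (x - y)]
  exact CompleteSpace.complete hc

theorem norm_twoPoint_sub_le {m : ℝ} (hm : 0 < m) {z : Spacetime} {ε δ L : ℝ}
    (hu : z.1 + z.2 ≠ 0) (hv : z.1 - z.2 ≠ 0) (huL : |z.1 + z.2| ≤ L) (hvL : |z.1 - z.2| ≤ L)
    (hε : ε ∈ Ioc 0 2) (hδ : δ ∈ Ioc 0 2) :
    ‖twoPoint m z - smoothedTwoPoint m (ε + (z.1 + z.2 : ℝ) * Complex.I)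
      (δ + (z.1 - z.2 : ℝ) * Complex.I)‖ ≤
      lipConstant m (4 + 2 * L) * (ε / |z.1 + z.2| + δ / |z.1 - z.2|) := by
  have h1 := ((tendsto_cutoffTwoPoint hm hu hv).sub_const (smoothedTwoPoint m
    (ε + (z.1 + z.2 : ℝ) * Complex.I) (δ + (z.1 - z.2 : ℝ) * Complex.I))).norm
  have h2 : Tendsto (fun η => lipConstant m (4 + 2 * L) *
      (|η - ε| / |z.1 + z.2| + |η - δ| / |z.1 - z.2|)) (𝓝[>] 0)
      (𝓝 (lipConstant m (4 + 2 * L) * (ε / |z.1 + z.2| + δ / |z.1 - z.2|))) := by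
    have hc : Continuous fun η : ℝ => lipConstant m (4 + 2 * L) *
      (|η - ε| / |z.1 + z.2| + |η - δ| / |z.1 - z.2|) := by fun_prop
    have := (hc.tendsto 0).mono_left (nhdsWithin_le_nhds (s := Ioi 0))
    simpa [abs_of_pos hε.1, abs_of_pos hδ.1] using this
  refine le_of_tendsto_of_tendsto h1 h2 ?_
  filter_upwards [Ioc_mem_nhdsGT (two_pos : (0 : ℝ) < 2)] with η hη
  exact norm_smoothedTwoPoint_sub_le₂ hm hu hv huL hvL hη hε hη hδ

lemma cutoffTwoPoint_time_neg (m ε : ℝ) (z : Spacetime) :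
    cutoffTwoPoint m ε (-z.1, z.2) = (starRingEnd ℂ) (cutoffTwoPoint m ε z) := by
  rw [cutoffTwoPoint, cutoffTwoPoint, smoothedTwoPoint_comm, ← smoothedTwoPoint_conj]
  congr 1 <;> simp <;> ring

lemma twoPoint_time_neg {m : ℝ} (hm : 0 < m) {z : Spacetime} (hu : z.1 + z.2 ≠ 0)
    (hv : z.1 - z.2 ≠ 0) : twoPoint m (-z.1, z.2) = (starRingEnd ℂ) (twoPoint m z) := by
  have h1 := tendsto_cutoffTwoPoint hm (z := (-z.1, z.2))
    (by simpa using fun h => hv (by linarith)) (by simpa using fun h => hu (by linarith))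
  refine tendsto_nhds_unique h1 ?_
  simp only [cutoffTwoPoint_time_neg]
  exact (Complex.continuous_conj.tendsto _).comp (tendsto_cutoffTwoPoint hm hu hv)

/-- Conjugation does not change the real part, so positivity of the two-point function becomes
available for the time-ordered exponential. -/
lemma re_feynman {m : ℝ} (hm : 0 < m) {z : Spacetime} (hu : z.1 + z.2 ≠ 0)
    (hv : z.1 - z.2 ≠ 0) : (feynman m z).re = (twoPoint m z).re := by
  rw [feynman]
  split_ifs
  · rfl
  · rw [twoPoint_time_neg hm hu hv, Complex.conj_re]

theorem abs_re_feynman_sub_le {m : ℝ} (hm : 0 < m) {z : Spacetime} {ε δ L : ℝ}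
    (hu : z.1 + z.2 ≠ 0) (hv : z.1 - z.2 ≠ 0) (huL : |z.1 + z.2| ≤ L) (hvL : |z.1 - z.2| ≤ L)
    (hε : ε ∈ Ioc 0 2) (hδ : δ ∈ Ioc 0 2) :
    |(feynman m z).re - (smoothedTwoPoint m (ε + (z.1 + z.2 : ℝ) * Complex.I)
      (δ + (z.1 - z.2 : ℝ) * Complex.I)).re| ≤
      lipConstant m (4 + 2 * L) * (ε / |z.1 + z.2| + δ / |z.1 - z.2|) := by
  rw [re_feynman hm hu hv, ← Complex.sub_re]
  exact (Complex.abs_re_le_norm _).trans (norm_twoPoint_sub_le hm hu hv huL hvL hε hδ)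

/-! ### An integrable majorant uniform in the cutoff -/

/-- In the variable `σ = √ε` the derivative gains a factor `2σ`, and `|a| ≥ max(σ², |u|) ≥ σ√|u|`
cancels the `σ`. The logarithm is thus replaced by the cruder but integrable `|u|^(-1/2)`. -/
lemma norm_smoothedTwoPoint_sub_le_sqrt {m : ℝ} (hm : 0 < m) {u ε₁ ε₂ R : ℝ} {b : ℂ} (hu : u ≠ 0)
    (h1 : ε₁ ∈ Ioc 0 1) (h2 : ε₂ ∈ Ioc 0 1) (hb : 0 < b.re) (hR : 1 + |u| + ‖b‖ ≤ R) :
    ‖smoothedTwoPoint m (ε₁ + u * Complex.I) b - smoothedTwoPoint m (ε₂ + u * Complex.I) b‖ ≤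
      2 * lipConstant m R / √|u| := by
  have hR0 : 0 ≤ R := by
    have := abs_nonneg u; have := norm_nonneg b; linarith
  have hu' := abs_pos.2 hu
  have hder : ∀ σ ∈ Ioc (0 : ℝ) 1, HasDerivWithinAt
      (fun σ : ℝ => smoothedTwoPoint m ((σ ^ 2 : ℝ) + u * Complex.I) b)
      ((2 * σ : ℝ) • (-(((1 / (4 * π) : ℝ) : ℂ) *
        ∫ k, lightConeFlux m ((σ ^ 2 : ℝ) + u * Complex.I) b k))) (Ioc 0 1) σ := by
    intro σ hσ
    have hre : 0 < (((σ ^ 2 : ℝ) : ℂ) + u * Complex.I).re := by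
      have := hσ.1
      rw [Complex.add_re, Complex.ofReal_re, Complex.re_ofReal_mul, Complex.I_re, mul_zero, add_zero]
      positivity
    have h : HasDerivAt (fun σ : ℝ => ((σ ^ 2 : ℝ) : ℂ) + u * Complex.I) ((2 * σ : ℝ) : ℂ) σ := by
      have := ((hasDerivAt_pow 2 σ).ofReal_comp).add_const (u * Complex.I)
      simpa using this
    refine (((hasDerivAt_smoothedTwoPoint hm hre hb).scomp σ h).congr_deriv
      ?_).hasDerivWithinAt
    rw [smul_eq_mul, Complex.real_smul]
  have hbd : ∀ σ ∈ Ioc (0 : ℝ) 1, ‖(2 * σ : ℝ) • (-(((1 / (4 * π) : ℝ) : ℂ) *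
        ∫ k, lightConeFlux m ((σ ^ 2 : ℝ) + u * Complex.I) b k))‖ ≤
        2 * lipConstant m R / √|u| := by
    intro σ hσ
    have hσ0 := hσ.1
    have hσ1 : σ ^ 2 ≤ 1 := by nlinarith [hσ.2]
    have hre : 0 < (((σ ^ 2 : ℝ) : ℂ) + u * Complex.I).re := by
      rw [Complex.add_re, Complex.ofReal_re, Complex.re_ofReal_mul, Complex.I_re, mul_zero, add_zero]
      positivity
    have hle : ‖((σ ^ 2 : ℝ) : ℂ) + u * Complex.I‖ ≤ 1 + |u| := by
      refine (norm_add_le _ _).trans ?_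
      simp only [Complex.norm_real, norm_mul, Complex.norm_I, mul_one, Real.norm_eq_abs]
      rw [abs_of_pos (by positivity)]
      linarith
    have hge : σ * √|u| ≤ ‖((σ ^ 2 : ℝ) : ℂ) + u * Complex.I‖ := by
      have e1 : |u| ≤ ‖((σ ^ 2 : ℝ) : ℂ) + u * Complex.I‖ := by
        simpa [-Complex.ofReal_pow] using
          Complex.abs_im_le_norm (((σ ^ 2 : ℝ) : ℂ) + u * Complex.I)
      have e2 : σ ^ 2 ≤ ‖((σ ^ 2 : ℝ) : ℂ) + u * Complex.I‖ := by
        have := Complex.re_le_norm (((σ ^ 2 : ℝ) : ℂ) + u * Complex.I)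
        simpa [-Complex.ofReal_pow] using this
      apply le_of_sq_le_sq _ (norm_nonneg _)
      rw [mul_pow, Real.sq_sqrt (abs_nonneg u), sq ‖_‖]
      exact mul_le_mul e2 e1 (abs_nonneg u) (norm_nonneg _)
    have hpos : 0 < σ * √|u| := by positivity
    rw [norm_smul, Real.norm_of_nonneg (by positivity)]
    calc _ ≤ 2 * σ * (lipConstant m R / ‖((σ ^ 2 : ℝ) : ℂ) + u * Complex.I‖) :=
          mul_le_mul_of_nonneg_left
            (norm_deriv_smoothedTwoPoint_le hm hre hb (by linarith)) (by positivity)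
      _ ≤ 2 * σ * (lipConstant m R / (σ * √|u|)) :=
          mul_le_mul_of_nonneg_left (div_le_div_of_nonneg_left (lipConstant_nonneg m hR0)
            hpos hge) (by positivity)
      _ = _ := by
          have : √|u| ≠ 0 := (Real.sqrt_pos.2 hu').ne'
          field_simp
  have hs : ∀ ε ∈ Ioc (0 : ℝ) 1, √ε ∈ Ioc (0 : ℝ) 1 := fun ε hε =>
    ⟨Real.sqrt_pos.2 hε.1, Real.sqrt_le_one.2 hε.2⟩
  have := (convex_Ioc 0 1).norm_image_sub_le_of_norm_hasDerivWithin_le hder hbd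
    (hs _ h2) (hs _ h1)
  rw [Real.sq_sqrt h1.1.le, Real.sq_sqrt h2.1.le] at this
  refine this.trans (mul_le_of_le_one_right
    (div_nonneg (mul_nonneg two_pos.le (lipConstant_nonneg m hR0)) (Real.sqrt_nonneg _)) ?_)
  rw [Real.norm_eq_abs, abs_le]
  constructor <;> linarith [(hs _ h1).1, (hs _ h1).2, (hs _ h2).1, (hs _ h2).2]

lemma norm_smoothedTwoPoint_le {m : ℝ} (hm : 0 < m) {a b : ℂ} (ha : 1 ≤ a.re) (hb : 1 ≤ b.re) :
    ‖smoothedTwoPoint m a b‖ ≤ 1 / (4 * π) * (1 / m * ∫ k, Real.exp (-(1 * energy m k))) := by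
  rw [smoothedTwoPoint, norm_mul, Complex.norm_real, Real.norm_of_nonneg (by positivity)]
  apply mul_le_mul_of_nonneg_left _ (by positivity)
  rw [← integral_const_mul]
  refine norm_integral_le_of_norm_le ((integrable_exp_neg_mul_energy hm one_pos).const_mul _)
    (Eventually.of_forall fun k => ?_)
  rw [norm_mul, Complex.norm_real, Real.norm_of_nonneg (one_div_nonneg.2 (energy_pos hm k).le)]
  exact mul_le_mul (one_div_energy_le hm k) (norm_lightConeMode_le m ha hb k) (norm_nonneg _)
    (by positivity)

theorem exists_norm_cutoffTwoPoint_le {m : ℝ} (hm : 0 < m) (L : ℝ) :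
    ∃ B : ℝ, 0 ≤ B ∧ ∀ z : Spacetime, z.1 + z.2 ≠ 0 → z.1 - z.2 ≠ 0 → |z.1 + z.2| ≤ L →
      |z.1 - z.2| ≤ L → ∀ ε ∈ Ioc (0 : ℝ) 1,
        ‖cutoffTwoPoint m ε z‖ ≤ B * (1 + 1 / √|z.1 + z.2| + 1 / √|z.1 - z.2|) := by
  set A := 1 / (4 * π) * (1 / m * ∫ k, Real.exp (-(1 * energy m k)))
  set Λ := 2 * lipConstant m (4 + 2 * L)
  refine ⟨max A Λ ⊔ 0, le_max_right _ _, fun z hu hv huL hvL ε hε => ?_⟩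
  set u := z.1 + z.2
  set v := z.1 - z.2
  have h1 : (1 : ℝ) ∈ Ioc (0 : ℝ) 1 := ⟨one_pos, le_rfl⟩
  have hε2 : ε ≤ 2 := hε.2.trans one_le_two
  have e1 := norm_smoothedTwoPoint_sub_le_sqrt hm hu hε h1 (b := ε + v * Complex.I)
    (R := 4 + 2 * L) (by simpa using hε.1)
    (by linarith [norm_add_mul_I_le hε.1 hε2 hvL])
  have e2 := norm_smoothedTwoPoint_sub_le_sqrt hm hv hε h1 (b := (1 : ℝ) + u * Complex.I)
    (R := 4 + 2 * L) (by simp)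
    (by linarith [norm_add_mul_I_le one_pos one_le_two huL])
  rw [smoothedTwoPoint_comm m _ ((1 : ℝ) + u * Complex.I),
    smoothedTwoPoint_comm m _ ((1 : ℝ) + u * Complex.I)] at e2
  have e3 : ‖smoothedTwoPoint m ((1 : ℝ) + u * Complex.I) ((1 : ℝ) + v * Complex.I)‖ ≤ A :=
    norm_smoothedTwoPoint_le hm (by simp) (by simp)
  set P := smoothedTwoPoint m ((1 : ℝ) + u * Complex.I) ((1 : ℝ) + v * Complex.I)
  set Q := smoothedTwoPoint m ((1 : ℝ) + u * Complex.I) (ε + v * Complex.I)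
  -- The cutoff `(ε, ε)` is joined to `(1, 1)` through `(1, ε)`; at `(1, 1)` the function is
  -- bounded.
  have e4 : cutoffTwoPoint m ε z = (cutoffTwoPoint m ε z - Q) + (Q - P) + P := by ring
  rw [e4]
  refine norm_add₃_le.trans ((add_le_add (add_le_add e1 e2) e3).trans ?_)
  have b1 : A ≤ max A Λ ⊔ 0 := (le_max_left _ _).trans (le_max_left _ _)
  have b2 : Λ ≤ max A Λ ⊔ 0 := (le_max_right _ _).trans (le_max_left _ _)
  have g1 : 0 ≤ 1 / √|u| := by positivity
  have g2 : 0 ≤ 1 / √|v| := by positivity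
  rw [div_eq_mul_one_div Λ, div_eq_mul_one_div Λ √|v|]
  nlinarith [mul_le_mul_of_nonneg_right b2 g1, mul_le_mul_of_nonneg_right b2 g2]

/-! ### Integration in light-cone coordinates and measurability -/

/-- The change to `u = t + x`, `v = t - x` decouples the two factors. Its Jacobian `1/2` is
discarded, whence an inequality. -/
theorem lintegral_lightCone_mul_le {h k : ℝ → ℝ≥0∞} (hh : Measurable h) (hk : Measurable k) :
    ∫⁻ z : Spacetime, h (z.1 + z.2) * k (z.1 - z.2) ≤ (∫⁻ u, h u) * ∫⁻ v, k v := by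
  have hmeas : Measurable fun z : ℝ × ℝ => h (z.1 + z.2) * k (z.1 - z.2) := by fun_prop
  rw [Measure.volume_eq_prod, lintegral_prod_symm _ hmeas.aemeasurable]
  have h1 : ∀ y : ℝ, ∫⁻ x, h (x + y) * k (x - y) = ∫⁻ x, h x * k (x - 2 * y) := by
    intro y
    rw [← lintegral_add_right_eq_self (fun x => h x * k (x - 2 * y)) y]
    congr 1
    ext x
    congr 2
    ring
  simp only [h1]
  rw [lintegral_lintegral_swap (by fun_prop)]
  have h2 : ∀ x : ℝ, ∫⁻ y, h x * k (x - 2 * y) ≤ h x * ∫⁻ v, k v := by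
    intro x
    rw [lintegral_const_mul _ (by fun_prop)]
    refine mul_le_mul' le_rfl ?_
    have h3 : ∫⁻ y : ℝ, k (x - 2 * y) = ∫⁻ w, k (x + w) ∂(Measure.map (-2 * ·) volume) := by
      rw [lintegral_map (by fun_prop) (by fun_prop)]
      congr 1
      ext y
      congr 1
      ring
    rw [h3, Real.map_volume_mul_left (by norm_num), lintegral_smul_measure,
      lintegral_add_left_eq_self]
    refine (mul_le_mul_left ?_ _).trans_eq (one_mul _)
    rw [ENNReal.ofReal_le_one]
    norm_num
  refine (lintegral_mono h2).trans_eq ?_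
  rw [lintegral_mul_const _ hh]

lemma measurable_singularity (b : ℝ) : Measurable fun w : ℝ => ENNReal.ofReal |w| ^ (-b) := by
  fun_prop

lemma lintegral_singularity_lt_top {b : ℝ} (hb1 : b < 1) (L : ℝ) :
    ∫⁻ w in Icc (-L) L, ENNReal.ofReal |w| ^ (-b) < ⊤ := by
  rcases lt_or_ge L 0 with hL | hL
  · rw [Icc_eq_empty (by linarith)]
    simp
  have h0 : IntervalIntegrable (fun w : ℝ => |w| ^ (-b)) volume 0 L := by
    refine (intervalIntegral.intervalIntegrable_rpow' (r := -b) (by linarith)).congr ?_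
    intro w hw
    rw [uIoc_of_le hL] at hw
    simp only [abs_of_pos hw.1]
  have h1 : IntervalIntegrable (fun w : ℝ => |w| ^ (-b)) volume (-L) 0 := by
    rw [IntervalIntegrable.iff_comp_neg]
    simpa using h0.symm
  have h2 := (intervalIntegrable_iff_integrableOn_Ioc_of_le (by linarith)).1 (h1.trans h0)
  rw [← integrableOn_Icc_iff_integrableOn_Ioc] at h2
  have h3 := h2.lintegral_lt_top
  refine lt_of_eq_of_lt ?_ h3
  refine lintegral_congr_ae (ae_restrict_of_ae ?_)
  have : ∀ᵐ w : ℝ, w ≠ 0 := by simp [ae_iff]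
  filter_upwards [this] with w hw
  rw [ENNReal.ofReal_rpow_of_pos (abs_pos.2 hw)]

/-- The points off the light cone. -/
def offLightCone : Set Spacetime := {z | z.1 + z.2 ≠ 0 ∧ z.1 - z.2 ≠ 0}

lemma isOpen_offLightCone : IsOpen offLightCone :=
  (isOpen_ne_fun (by fun_prop) (by fun_prop)).inter (isOpen_ne_fun (by fun_prop) (by fun_prop))

lemma ae_linearMap_ne_zero {E : Type*} [NormedAddCommGroup E] [NormedSpace ℝ E]
    [MeasurableSpace E] [BorelSpace E] [FiniteDimensional ℝ E] (ν : Measure E)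
    [ν.IsAddHaarMeasure] (ℓ : E →ₗ[ℝ] ℝ) (h : ℓ ≠ 0) : ∀ᵐ x ∂ν, ℓ x ≠ 0 := by
  have := Measure.addHaar_submodule ν (LinearMap.ker ℓ) (fun h' => h (LinearMap.ker_eq_top.1 h'))
  rw [ae_iff]
  convert this using 2
  ext x
  simp

lemma ae_mem_offLightCone : ∀ᵐ z : Spacetime, z ∈ offLightCone := by
  have h1 := ae_linearMap_ne_zero (volume : Measure Spacetime)
    (LinearMap.fst ℝ ℝ ℝ + LinearMap.snd ℝ ℝ ℝ)
    (fun h => by simpa using LinearMap.congr_fun h (1, 0))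
  have h2 := ae_linearMap_ne_zero (volume : Measure Spacetime)
    (LinearMap.fst ℝ ℝ ℝ - LinearMap.snd ℝ ℝ ℝ)
    (fun h => by simpa using LinearMap.congr_fun h (1, 0))
  filter_upwards [h1, h2] with z hz1 hz2
  exact ⟨by simpa using hz1, by simpa using hz2⟩

lemma continuous_planeWave (m k : ℝ) : Continuous (planeWave m k) := by
  unfold planeWave; fun_prop

lemma norm_planeWave (m k : ℝ) (z : Spacetime) : ‖planeWave m k z‖ = 1 := by
  rw [planeWave, mul_comm, Complex.norm_exp_ofReal_mul_I]

lemma continuous_weight {m : ℝ} (hm : 0 < m) (ε : ℝ) :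
    Continuous fun k => ((1 / (2 * energy m k) * Real.exp (-ε * energy m k) : ℝ) : ℂ) := by
  have h1 := continuous_energy m
  have h2 := continuous_inv_energy hm
  have : (fun k => ((1 / (2 * energy m k) * Real.exp (-ε * energy m k) : ℝ) : ℂ)) =
      fun k => ((1 / 2 * (1 / energy m k) * Real.exp (-ε * energy m k) : ℝ) : ℂ) := by
    ext k; congr 1; ring
  rw [this]
  fun_prop

lemma continuous_cutoffTwoPoint {m : ℝ} (hm : 0 < m) {ε : ℝ} (hε : 0 < ε) :
    Continuous (cutoffTwoPoint m ε) := by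
  have hE := continuous_weight hm ε
  have : cutoffTwoPoint m ε = fun z => ((1 / (2 * π) : ℝ) : ℂ) *
      ∫ k : ℝ, ((1 / (2 * energy m k) * Real.exp (-ε * energy m k) : ℝ) : ℂ) * planeWave m k z :=
    funext fun z => cutoffTwoPoint_eq m ε z
  rw [this]
  refine continuous_const.mul (continuous_of_dominated
    (bound := fun k => 1 / m * Real.exp (-(ε * energy m k))) (fun z => ?_) (fun z => ?_) ?_ ?_)
  · have h1 := continuous_energy m
    refine (hE.mul ?_).aestronglyMeasurable
    unfold planeWave
    fun_prop
  · refine Eventually.of_forall fun k => ?_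
    rw [norm_mul, norm_planeWave, mul_one, Complex.norm_real, norm_mul, Real.norm_eq_abs,
      Real.norm_eq_abs, Real.abs_exp, neg_mul]
    gcongr
    have h1 := energy_pos hm k
    rw [abs_of_nonneg (by positivity)]
    refine le_trans ?_ (one_div_energy_le hm k)
    exact one_div_le_one_div_of_le h1 (by linarith)
  · exact (integrable_exp_neg_mul_energy hm hε).const_mul _
  · exact Eventually.of_forall fun k => continuous_const.mul (continuous_planeWave m k)

/-- Off the cone the function is a pointwise limit of continuous cutoff functions; the indicator
removes the points where no limit has been established. -/
lemma measurable_indicator_twoPoint {m : ℝ} (hm : 0 < m) :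
    Measurable (offLightCone.indicator (twoPoint m)) := by
  have hlim : Tendsto (fun n : ℕ => (1 / ((n : ℝ) + 1))) atTop (𝓝[>] 0) :=
    tendsto_nhdsWithin_iff.2 ⟨tendsto_one_div_add_atTop_nhds_zero_nat,
      Eventually.of_forall fun n => by simp only [mem_Ioi]; positivity⟩
  refine measurable_of_tendsto_metrizable
    (f := fun n : ℕ => offLightCone.indicator (cutoffTwoPoint m (1 / ((n : ℝ) + 1)))) (fun n => ?_) ?_
  · exact (continuous_cutoffTwoPoint hm (by positivity)).measurable.indicator
      isOpen_offLightCone.measurableSet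
  · rw [tendsto_pi_nhds]
    intro z
    by_cases hz : z ∈ offLightCone
    · simp only [indicator_of_mem hz]
      exact (tendsto_cutoffTwoPoint hm hz.1 hz.2).comp hlim
    · simp only [indicator_of_notMem hz]
      exact tendsto_const_nhds

lemma aestronglyMeasurable_twoPoint {m : ℝ} (hm : 0 < m) :
    AEStronglyMeasurable (twoPoint m) volume := by
  refine (measurable_indicator_twoPoint hm).aestronglyMeasurable.congr ?_
  filter_upwards [ae_mem_offLightCone] with z hz
  exact indicator_of_mem hz _

/-- The square `|t + x| ≤ L`, `|t - x| ≤ L`. -/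
def lightConeBox (L : ℝ) : Set Spacetime := {z | |z.1 + z.2| ≤ L ∧ |z.1 - z.2| ≤ L}

lemma measurableSet_lightConeBox (L : ℝ) : MeasurableSet (lightConeBox L) :=
  (measurableSet_le (f := fun z : Spacetime => |z.1 + z.2|) (by fun_prop) measurable_const).inter
    (measurableSet_le (f := fun z : Spacetime => |z.1 - z.2|) (by fun_prop) measurable_const)

lemma setLIntegral_lightConeBox_mul_le {h k : ℝ → ℝ≥0∞} (hh : Measurable h) (hk : Measurable k)
    (L : ℝ) :
    ∫⁻ z in lightConeBox L, h (z.1 + z.2) * k (z.1 - z.2) ≤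
      (∫⁻ u in Icc (-L) L, h u) * ∫⁻ v in Icc (-L) L, k v := by
  rw [← lintegral_indicator (measurableSet_lightConeBox L), ← lintegral_indicator measurableSet_Icc,
    ← lintegral_indicator measurableSet_Icc]
  refine le_trans (lintegral_mono fun z => ?_) (lintegral_lightCone_mul_le
    (hh.indicator measurableSet_Icc) (hk.indicator measurableSet_Icc))
  by_cases hz : z ∈ lightConeBox L
  · rw [indicator_of_mem hz, indicator_of_mem (mem_Icc.2 (abs_le.1 hz.1)),
      indicator_of_mem (mem_Icc.2 (abs_le.1 hz.2))]
  · rw [indicator_of_notMem hz]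
    exact zero_le

lemma integrableOn_lightConeBox_singularity (L : ℝ) :
    IntegrableOn (fun z : Spacetime => 1 + 1 / √|z.1 + z.2| + 1 / √|z.1 - z.2|)
      (lightConeBox L) := by
  have hS := lintegral_singularity_lt_top (b := 1 / 2) (by norm_num) L
  have h1 : ∫⁻ _ in Icc (-L) L, (1 : ℝ≥0∞) < ⊤ := by simp
  have hm := measurable_singularity (1 / 2)
  have hk : ∀ w : ℝ, ENNReal.ofReal (1 / √|w|) ≤ ENNReal.ofReal |w| ^ (-(1 / 2 : ℝ)) := by
    intro w
    rcases eq_or_ne w 0 with rfl | hw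
    · simp
    · rw [ENNReal.ofReal_rpow_of_pos (abs_pos.2 hw), Real.rpow_neg (abs_nonneg w),
        ← Real.sqrt_eq_rpow, one_div]
  refine ⟨?_, ?_⟩
  · have : Measurable fun z : Spacetime => 1 + 1 / √|z.1 + z.2| + 1 / √|z.1 - z.2| := by fun_prop
    exact this.aestronglyMeasurable
  · rw [hasFiniteIntegral_iff_ofReal (Eventually.of_forall fun z => by
      simp only [Pi.zero_apply]; positivity)]
    refine lt_of_le_of_lt (lintegral_mono (g := fun z : Spacetime =>
      (1 : ℝ≥0∞) * 1 + (ENNReal.ofReal |z.1 + z.2| ^ (-(1 / 2 : ℝ))) * 1 +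
        1 * (ENNReal.ofReal |z.1 - z.2| ^ (-(1 / 2 : ℝ)))) fun z => ?_) ?_
    · rw [ENNReal.ofReal_add (by positivity) (by positivity),
        ENNReal.ofReal_add (by positivity) (by positivity), ENNReal.ofReal_one]
      simp only [mul_one, one_mul]
      gcongr
      · exact hk _
      · exact hk _
    · rw [lintegral_add_right _ (by fun_prop), lintegral_add_right _ (by fun_prop)]
      refine ENNReal.add_lt_top.2 ⟨ENNReal.add_lt_top.2 ⟨?_, ?_⟩, ?_⟩
      · exact (setLIntegral_lightConeBox_mul_le (h := fun _ => 1) (k := fun _ => 1)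
          measurable_const measurable_const L).trans_lt (ENNReal.mul_lt_top h1 h1)
      · exact (setLIntegral_lightConeBox_mul_le (k := fun _ => 1) hm
          measurable_const L).trans_lt (ENNReal.mul_lt_top hS h1)
      · exact (setLIntegral_lightConeBox_mul_le (h := fun _ => 1) measurable_const hm
          L).trans_lt (ENNReal.mul_lt_top h1 hS)

lemma exists_subset_lightConeBox {K : Set Spacetime} (hK : IsCompact K) :
    ∃ L, K ⊆ lightConeBox L := by
  obtain ⟨R, hR⟩ := hK.exists_bound_of_continuousOn
    (f := fun z : Spacetime => (z.1 + z.2, z.1 - z.2)) (by fun_prop)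
  refine ⟨R, fun z hz => ?_⟩
  have := hR z hz
  exact ⟨(norm_fst_le (z.1 + z.2, z.1 - z.2)).trans this,
    (norm_snd_le (z.1 + z.2, z.1 - z.2)).trans this⟩

theorem exists_norm_twoPoint_le {m : ℝ} (hm : 0 < m) (L : ℝ) :
    ∃ B : ℝ, 0 ≤ B ∧ ∀ z ∈ offLightCone ∩ lightConeBox L,
      ‖twoPoint m z‖ ≤ B * (1 + 1 / √|z.1 + z.2| + 1 / √|z.1 - z.2|) ∧ ∀ ε ∈ Ioc (0 : ℝ) 1,
        ‖cutoffTwoPoint m ε z‖ ≤ B * (1 + 1 / √|z.1 + z.2| + 1 / √|z.1 - z.2|) := by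
  obtain ⟨B, hB, h⟩ := exists_norm_cutoffTwoPoint_le hm L
  refine ⟨B, hB, fun z hz => ?_⟩
  have h' := h z hz.1.1 hz.1.2 hz.2.1 hz.2.2
  refine ⟨?_, h'⟩
  refine le_of_tendsto (tendsto_cutoffTwoPoint hm hz.1.1 hz.1.2).norm ?_
  filter_upwards [Ioc_mem_nhdsGT (one_pos : (0 : ℝ) < 1)] with ε hε using h' ε hε

theorem locallyIntegrable_twoPoint {m : ℝ} (hm : 0 < m) :
    LocallyIntegrable (twoPoint m) volume := by
  rw [locallyIntegrable_iff]
  intro K hK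
  obtain ⟨L, hL⟩ := exists_subset_lightConeBox hK
  refine IntegrableOn.mono_set ?_ hL
  obtain ⟨B, -, hB⟩ := exists_norm_twoPoint_le hm L
  refine ((integrableOn_lightConeBox_singularity L).const_mul B).mono'
    (aestronglyMeasurable_twoPoint hm).restrict ?_
  filter_upwards [ae_restrict_of_ae ae_mem_offLightCone,
    ae_restrict_mem (measurableSet_lightConeBox L)] with z h1 h2
  exact (hB z ⟨h1, h2⟩).1

/-! ### The kernel of the vacuum distribution -/

lemma hasLineDerivAt_planeWave (m k : ℝ) (z : Spacetime) :
    HasLineDerivAt ℝ (planeWave m k)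
      (-(Complex.I * (energy m k : ℂ)) * planeWave m k z) z (1, 0) := by
  unfold HasLineDerivAt
  have h : HasDerivAt (fun τ : ℝ => k * z.2 - energy m k * (z.1 + τ)) (-energy m k) 0 := by
    have := ((((hasDerivAt_id (0 : ℝ)).const_add z.1).const_mul (energy m k)).const_sub (k * z.2))
    simpa using this
  have h2 := (h.ofReal_comp.const_mul Complex.I).cexp
  have e : (fun τ : ℝ => planeWave m k (z + τ • ((1 : ℝ), (0 : ℝ)))) = fun τ : ℝ =>
      Complex.exp (Complex.I * ((k * z.2 - energy m k * (z.1 + τ) : ℝ) : ℂ)) := by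
    ext τ
    simp [planeWave]
  rw [e]
  refine h2.congr_deriv ?_
  rw [planeWave, add_zero]
  push_cast
  ring

/-- The time derivative of a function on spacetime. -/
def timeDeriv (h : Spacetime → ℂ) (z : Spacetime) : ℂ := fderiv ℝ h z (1, 0)

lemma integrable_mul_planeWave {h : Spacetime → ℂ} (hh : Integrable h) (m k : ℝ) :
    Integrable fun z => h z * planeWave m k z := by
  refine hh.mul_bdd (c := 1) (continuous_planeWave m k).aestronglyMeasurable
    (Eventually.of_forall fun z => (norm_planeWave m k z).le)

lemma integrable_timeDeriv {h : Spacetime → ℂ} (hs : ContDiff ℝ ∞ h) (hc : HasCompactSupport h) :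
    Integrable (timeDeriv h) := by
  have h1 : Continuous (timeDeriv h) :=
    (hs.continuous_fderiv (by simp)).clm_apply continuous_const
  refine h1.integrable_of_hasCompactSupport ?_
  exact (hc.fderiv ℝ).comp_left (g := fun A : Spacetime →L[ℝ] ℂ => A (1, 0)) (by simp)

/-- Integration by parts in time. The gained factor `1/ω`, with the `1/ω` of the measure, dominates
the momentum integral uniformly in the cutoff. -/
lemma energy_mul_norm_integral_planeWave_le {m : ℝ} (hm : 0 < m) {h : Spacetime → ℂ}
    (hs : ContDiff ℝ ∞ h) (hc : HasCompactSupport h) (k : ℝ) :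
    energy m k * ‖∫ z, h z * planeWave m k z‖ ≤ ∫ z, ‖timeDeriv h z‖ := by
  have hi : Integrable h := hs.continuous.integrable_of_hasCompactSupport hc
  have hi' := integrable_timeDeriv hs hc
  have e : ∀ z, h z * (-(Complex.I * (energy m k : ℂ)) * planeWave m k z) =
      -(Complex.I * (energy m k : ℂ)) * (h z * planeWave m k z) := fun z => by ring
  have key := integral_bilinear_hasLineDerivAt_right_eq_neg_left_of_integrable
    (μ := (volume : Measure Spacetime)) (f := h) (f' := timeDeriv h) (g := planeWave m k)
    (g' := fun z => -(Complex.I * (energy m k : ℂ)) * planeWave m k z) (v := ((1 : ℝ), (0 : ℝ)))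
    (B := ContinuousLinearMap.mul ℝ ℂ) (integrable_mul_planeWave hi' m k)
    (by
      simp only [ContinuousLinearMap.mul_apply', e]
      exact (integrable_mul_planeWave hi m k).const_mul _)
    (integrable_mul_planeWave hi m k)
    (fun z _ => (hs.differentiable (by simp) z).hasFDerivAt.hasLineDerivAt _)
    (fun z _ => hasLineDerivAt_planeWave m k z)
  simp only [ContinuousLinearMap.mul_apply', e] at key
  rw [integral_const_mul] at key
  have h2 := congrArg norm key
  rw [norm_mul, norm_neg, norm_neg, norm_mul, Complex.norm_I, one_mul, Complex.norm_real,
    Real.norm_of_nonneg (energy_pos hm k).le] at h2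
  rw [h2]
  refine (norm_integral_le_integral_norm _).trans_eq ?_
  simp [norm_planeWave]

lemma integral_cutoffTwoPoint_mul {m : ℝ} (hm : 0 < m) {h : Spacetime → ℂ} (hh : Integrable h)
    {ε : ℝ} (hε : 0 < ε) :
    ∫ z, cutoffTwoPoint m ε z * h z = ((1 / (2 * π) : ℝ) : ℂ) *
      ∫ k : ℝ, ((1 / (2 * energy m k) * Real.exp (-ε * energy m k) : ℝ) : ℂ) *
        ∫ z, h z * planeWave m k z := by
  set c : ℝ → ℂ := fun k => ((1 / (2 * energy m k) * Real.exp (-ε * energy m k) : ℝ) : ℂ) with hc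
  have hci : Integrable c := by
    refine ((integrable_exp_neg_mul_energy hm hε).const_mul (1 / m)).mono'
      (continuous_weight hm ε).aestronglyMeasurable (Eventually.of_forall fun k => ?_)
    have h1 := energy_pos hm k
    rw [hc, Complex.norm_real, Real.norm_of_nonneg (by positivity), neg_mul]
    exact mul_le_mul_of_nonneg_right ((one_div_le_one_div_of_le h1 (by linarith)).trans
      (one_div_energy_le hm k)) (Real.exp_pos _).le
  have hint : Integrable (Function.uncurry fun (z : Spacetime) (k : ℝ) =>
      c k * (h z * planeWave m k z)) (volume.prod volume) := by
    have hp : Continuous fun y : Spacetime × ℝ => planeWave m y.2 y.1 := by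
      have := continuous_energy m
      unfold planeWave
      fun_prop
    refine ((hh.mul_prod hci).mul_bdd (c := 1) hp.aestronglyMeasurable
      (Eventually.of_forall fun y => (norm_planeWave m y.2 y.1).le)).congr
      (Eventually.of_forall fun y => ?_)
    simp only [Function.uncurry]
    ring
  have e1 : ∀ z, cutoffTwoPoint m ε z * h z =
      ((1 / (2 * π) : ℝ) : ℂ) * ∫ k, c k * (h z * planeWave m k z) := by
    intro z
    rw [cutoffTwoPoint_eq, mul_assoc, ← integral_mul_const]
    congr 2
    ext k
    ring
  simp only [e1]
  rw [integral_const_mul, integral_integral_swap hint]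
  simp only [integral_const_mul, hc]

/-- With a cutoff the identity is Fubini. As `ε ↓ 0` both sides converge by dominated convergence,
with majorants in position space and in momentum space respectively. -/
theorem isVacuumKernel_twoPoint {m : ℝ} (hm : 0 < m) : IsVacuumKernel m (twoPoint m) := by
  refine ⟨locallyIntegrable_twoPoint hm, fun h hs hcs => ?_⟩
  have hi : Integrable h := hs.continuous.integrable_of_hasCompactSupport hcs
  obtain ⟨L, hL⟩ := exists_subset_lightConeBox hcs
  obtain ⟨B, hB0, hB⟩ := exists_norm_twoPoint_le hm L
  obtain ⟨H, hH⟩ := hcs.exists_bound_of_continuous hs.continuous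
  have hH0 : 0 ≤ H := (norm_nonneg _).trans (hH 0)
  have lim1 : Tendsto (fun ε => ∫ z, cutoffTwoPoint m ε z * h z) (𝓝[>] 0)
      (𝓝 (∫ z, twoPoint m z * h z)) := by
    refine tendsto_integral_filter_of_dominated_convergence
      ((lightConeBox L).indicator fun z => B * (1 + 1 / √|z.1 + z.2| + 1 / √|z.1 - z.2|) * H)
      ?_ ?_ ?_ ?_
    · filter_upwards [self_mem_nhdsWithin] with ε hε
      exact ((continuous_cutoffTwoPoint hm hε).mul hs.continuous).aestronglyMeasurable
    · filter_upwards [Ioc_mem_nhdsGT (one_pos : (0 : ℝ) < 1)] with ε hε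
      filter_upwards [ae_mem_offLightCone] with z hz
      by_cases hzL : z ∈ lightConeBox L
      · rw [indicator_of_mem hzL, norm_mul]
        exact mul_le_mul ((hB z ⟨hz, hzL⟩).2 ε hε) (hH z) (norm_nonneg _) (by positivity)
      · rw [indicator_of_notMem hzL, image_eq_zero_of_notMem_tsupport fun h' => hzL (hL h')]
        simp
    · rw [integrable_indicator_iff (measurableSet_lightConeBox L)]
      exact ((integrableOn_lightConeBox_singularity L).const_mul B).mul_const H
    · filter_upwards [ae_mem_offLightCone] with z hz
      exact (tendsto_cutoffTwoPoint hm hz.1 hz.2).mul_const _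
  have lim2 : Tendsto (fun ε => ∫ k : ℝ, ((1 / (2 * energy m k) * Real.exp (-ε * energy m k) : ℝ) :
      ℂ) * ∫ z, h z * planeWave m k z) (𝓝[>] 0)
      (𝓝 (∫ k : ℝ, ((1 / (2 * energy m k) : ℝ) : ℂ) * ∫ z, h z * planeWave m k z)) := by
    have hmeas : AEStronglyMeasurable (fun k => ∫ z, h z * planeWave m k z) volume := by
      refine (continuous_of_dominated (bound := fun z => ‖h z‖) (fun k => ?_) (fun k => ?_)
        hi.norm ?_).aestronglyMeasurable
      · exact (integrable_mul_planeWave hi m k).aestronglyMeasurable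
      · exact Eventually.of_forall fun z => by rw [norm_mul, norm_planeWave, mul_one]
      · refine Eventually.of_forall fun z => ?_
        have := continuous_energy m
        unfold planeWave
        fun_prop
    refine tendsto_integral_filter_of_dominated_convergence
      (fun k => (∫ z, ‖timeDeriv h z‖) * (energy m k ^ 2)⁻¹) ?_ ?_
      ((integrable_inv_energy_sq hm).const_mul _) ?_
    · exact Eventually.of_forall fun ε =>
        (continuous_weight hm ε).aestronglyMeasurable.mul hmeas
    · filter_upwards [self_mem_nhdsWithin] with ε hε
      refine Eventually.of_forall fun k => ?_
      have h1 := energy_pos hm k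
      have h2 := energy_mul_norm_integral_planeWave_le hm hs hcs k
      have h3 : Real.exp (-ε * energy m k) ≤ 1 := by
        rw [Real.exp_le_one_iff]
        nlinarith [mem_Ioi.1 hε]
      rw [norm_mul, Complex.norm_real, Real.norm_of_nonneg (by positivity)]
      calc _ ≤ 1 / energy m k * 1 * ‖∫ z, h z * planeWave m k z‖ := by
            gcongr
            linarith
        _ = energy m k * ‖∫ z, h z * planeWave m k z‖ * (energy m k ^ 2)⁻¹ := by
            field_simp
        _ ≤ _ := by gcongr
    · refine Eventually.of_forall fun k => ?_
      have hc : Continuous fun ε : ℝ => ((1 / (2 * energy m k) * Real.exp (-ε * energy m k) : ℝ) :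
          ℂ) * ∫ z, h z * planeWave m k z := by fun_prop
      have := (hc.tendsto 0).mono_left (nhdsWithin_le_nhds (s := Ioi 0))
      simpa using this
  refine tendsto_nhds_unique lim1 ?_
  rw [vacuumDistribution]
  refine (lim2.const_mul ((1 / (2 * π) : ℝ) : ℂ)).congr' ?_
  filter_upwards [self_mem_nhdsWithin] with ε hε
  rw [integral_cutoffTwoPoint_mul hm hi hε]

/-! ### Crowdings and stability of the gas of charges -/

/-- The crowding of the points `w₁, …, wₙ` of the line at `wᵢ`, an inverse length that is at least
`n` and at least the inverse of the distance to each other point. -/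
def crowding {n : ℕ} (w : Fin n → ℝ) (i : Fin n) : ℝ := n + ∑ j, |w i - w j|⁻¹

lemma one_le_crowding {n : ℕ} (w : Fin n → ℝ) (i : Fin n) : 1 ≤ crowding w i := by
  have h1 : (1 : ℝ) ≤ n := by exact_mod_cast (i.pos : 0 < n)
  have h2 : 0 ≤ ∑ j, |w i - w j|⁻¹ := Finset.sum_nonneg fun j _ => by positivity
  unfold crowding
  linarith

lemma crowding_pos {n : ℕ} (w : Fin n → ℝ) (i : Fin n) : 0 < crowding w i :=
  one_pos.trans_le (one_le_crowding w i)

lemma inv_crowding_mem {n : ℕ} (w : Fin n → ℝ) (i : Fin n) : (crowding w i)⁻¹ ∈ Ioc (0 : ℝ) 1 :=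
  ⟨inv_pos.2 (crowding_pos w i), inv_le_one_of_one_le₀ (one_le_crowding w i)⟩

lemma sum_sum_Ioi_of_symm {n : ℕ} (F : Fin n → Fin n → ℝ) (hF : ∀ i j, F i j = F j i) :
    2 * ∑ i, ∑ j ∈ Finset.Ioi i, F i j = ∑ i, ∑ j, F i j - ∑ i, F i i := by
  have h := Finset.sum_sum_Ioi_add_eq_sum_sum_off_diag F
  have h1 : ∀ i, ∑ j ∈ Finset.Ioi i, (F j i + F i j) = 2 * ∑ j ∈ Finset.Ioi i, F i j := by
    intro i
    rw [Finset.mul_sum]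
    exact Finset.sum_congr rfl fun j _ => by rw [hF j i]; ring
  have h2 : ∀ i, ∑ j ∈ {i}ᶜ, F j i = ∑ j, F i j - F i i := by
    intro i
    rw [← Finset.sum_compl_add_sum {i}, Finset.sum_singleton, add_sub_cancel_right]
    exact Finset.sum_congr rfl fun j _ => hF j i
  simp only [h1, h2, Finset.sum_sub_distrib, ← Finset.mul_sum] at h
  exact h

/-- The crowding at `i` dominates the sum of the inverse distances from point `i`, so each point
contributes at most one. This is what makes the total smearing error extensive. -/
lemma sum_sum_Ioi_inv_crowding_le {n : ℕ} (w : Fin n → ℝ) :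
    ∑ i, ∑ j ∈ Finset.Ioi i, ((crowding w i)⁻¹ + (crowding w j)⁻¹) / |w i - w j| ≤ n := by
  have h := sum_sum_Ioi_of_symm (fun i j => ((crowding w i)⁻¹ + (crowding w j)⁻¹) / |w i - w j|)
    (fun i j => by rw [add_comm, abs_sub_comm])
  have h1 : ∀ i, ∑ j, (crowding w i)⁻¹ * |w i - w j|⁻¹ ≤ 1 := by
    intro i
    rw [← Finset.mul_sum, inv_mul_le_iff₀ (crowding_pos w i), mul_one, crowding]
    linarith [(Nat.cast_nonneg n : (0 : ℝ) ≤ n)]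
  have h2 : ∑ i, ∑ j, ((crowding w i)⁻¹ + (crowding w j)⁻¹) / |w i - w j| =
      ∑ i, ∑ j, (crowding w i)⁻¹ * |w i - w j|⁻¹ + ∑ i, ∑ j, (crowding w i)⁻¹ * |w i - w j|⁻¹ := by
    nth_rewrite 3 [Finset.sum_comm]
    simp only [← Finset.sum_add_distrib]
    refine Finset.sum_congr rfl fun i _ => Finset.sum_congr rfl fun j _ => ?_
    rw [abs_sub_comm (w j)]
    ring
  have h3 : ∑ i : Fin n, ∑ j, (crowding w i)⁻¹ * |w i - w j|⁻¹ ≤ n := by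
    refine (Finset.sum_le_sum fun i _ => h1 i).trans_eq (by simp)
  -- Diagonal terms are divisions by zero and count as zero.
  have h4 : ∑ i, ((crowding w i)⁻¹ + (crowding w i)⁻¹) / |w i - w i| = 0 := by simp
  rw [h2, h4] at h
  linarith

lemma smoothedTwoPoint_sub_symm (m ε δ u u' v v' : ℝ) :
    (smoothedTwoPoint m (ε + (u - u' : ℝ) * Complex.I) (δ + (v - v' : ℝ) * Complex.I)).re =
      (smoothedTwoPoint m (ε + (u' - u : ℝ) * Complex.I) (δ + (v' - v : ℝ) * Complex.I)).re := by
  rw [← Complex.conj_re, ← smoothedTwoPoint_conj]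
  congr 2 <;> simp <;> ring

/-- The extensive constant of the stability estimate. -/
def stabilityConstant (m μ r : ℝ) : ℝ :=
  r ^ 2 * (selfEnergyConstant m / 2 + 2 * lipConstant m (4 + 2 * (2 * μ)))

/-- Stability of the gas of charges with interaction `Re Δ_F`: the energy is bounded below by the
self energies of the charges smeared over their inverse crowdings. -/
theorem neg_energy_le {m μ r : ℝ} (hm : 0 < m) (hμ : 0 < μ) {n : ℕ} {s : Fin n → ℝ}
    (hs : ∀ i, |s i| ≤ r) {x : Fin n → Spacetime} (hx : ∀ i, x i ∈ doubleCone μ)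
    (hx' : ∀ i j, i ≠ j → x i - x j ∈ offLightCone) :
    -∑ l, ∑ j ∈ Finset.Ioi l, s l * s j * (feynman m (x l - x j)).re ≤
      n * stabilityConstant m μ r + r ^ 2 / (8 * π) *
        ∑ i, (Real.log (crowding (fun i => (x i).1 + (x i).2) i) +
          Real.log (crowding (fun i => (x i).1 - (x i).2) i)) := by
  set U : Fin n → ℝ := fun i => (x i).1 + (x i).2 with hU
  set V : Fin n → ℝ := fun i => (x i).1 - (x i).2 with hV
  set ε : Fin n → ℝ := fun i => (crowding U i)⁻¹ with hε
  set δ : Fin n → ℝ := fun i => (crowding V i)⁻¹ with hδ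
  set Λ := lipConstant m (4 + 2 * (2 * μ))
  have hΛ : 0 ≤ Λ := lipConstant_nonneg m (by linarith)
  have hε1 : ∀ i, ε i ∈ Ioc (0 : ℝ) 1 := inv_crowding_mem U
  have hδ1 : ∀ i, δ i ∈ Ioc (0 : ℝ) 1 := inv_crowding_mem V
  -- The smeared pair potential; the cutoffs of the two charges add because each charge is smeared
  -- separately.
  set G : Fin n → Fin n → ℝ := fun i j =>
    (smoothedTwoPoint m ((ε i + ε j : ℝ) + (U i - U j : ℝ) * Complex.I)
      ((δ i + δ j : ℝ) + (V i - V j : ℝ) * Complex.I)).re with hG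
  have hsub1 : ∀ i j, (x i - x j).1 + (x i - x j).2 = U i - U j := fun i j => by
    simp only [hU, Prod.fst_sub, Prod.snd_sub]; ring
  have hsub2 : ∀ i j, (x i - x j).1 - (x i - x j).2 = V i - V j := fun i j => by
    simp only [hV, Prod.fst_sub, Prod.snd_sub]; ring
  have hGsymm : ∀ i j, G i j = G j i := by
    intro i j
    simp only [hG]
    rw [smoothedTwoPoint_sub_symm, add_comm (ε i), add_comm (δ i)]
  have hpos : 0 ≤ ∑ i, ∑ j, s i * s j * G i j := by
    have h := sum_smoothedTwoPoint_nonneg hm s (fun i => (ε i : ℂ) + U i * Complex.I)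
      (fun i => (δ i : ℂ) + V i * Complex.I) (fun i => by simpa using (hε1 i).1)
      (fun i => by simpa using (hδ1 i).1)
    refine h.trans_eq (Finset.sum_congr rfl fun i _ => Finset.sum_congr rfl fun j _ => ?_)
    simp only [hG]
    congr 3 <;> simp <;> ring
  have hself : ∀ i, s i * s i * G i i ≤ r ^ 2 * (1 / (4 * π) *
      (Real.log (crowding U i) + Real.log (crowding V i)) + selfEnergyConstant m) := by
    intro i
    have h := re_smoothedTwoPoint_self_le hm (hε1 i).1 (hε1 i).2 (hδ1 i).1 (hδ1 i).2
    have e : G i i = (smoothedTwoPoint m ((2 * ε i : ℝ) : ℂ) ((2 * δ i : ℝ) : ℂ)).re := by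
      simp only [hG]
      congr 2 <;> simp <;> ring
    rw [← e] at h
    simp only [hε, hδ, Real.log_inv, neg_neg] at h
    have hlog1 := Real.log_nonneg (one_le_crowding U i)
    have hlog2 := Real.log_nonneg (one_le_crowding V i)
    have hself := selfEnergyConstant_nonneg m
    have hs2 : s i * s i ≤ r ^ 2 := by
      have := sq_le_sq' (by linarith [neg_abs_le (s i), hs i]) ((le_abs_self _).trans (hs i))
      nlinarith
    have hnn : 0 ≤ 1 / (4 * π) *
      (Real.log (crowding U i) + Real.log (crowding V i)) + selfEnergyConstant m := by positivity
    exact (mul_le_mul_of_nonneg_left h (mul_self_nonneg _)).trans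
      (mul_le_mul_of_nonneg_right hs2 hnn)
  have hdist : ∀ i j, |U i - U j| ≤ 2 * μ ∧ |V i - V j| ≤ 2 * μ := by
    intro i j
    obtain ⟨a1, a2, a3, a4⟩ := hx i
    obtain ⟨b1, b2, b3, b4⟩ := hx j
    simp only [hU, hV]
    constructor <;> rw [abs_le] <;> constructor <;> linarith
  -- Price of smearing one pair. Cutoffs at most 1 add up to at most 2, the range of the comparison
  -- lemma.
  have herr : ∀ i, ∀ j ∈ Finset.Ioi i, -(s i * s j * (feynman m (x i - x j)).re) ≤
      -(s i * s j * G i j) + r ^ 2 * (Λ * ((ε i + ε j) / |U i - U j| +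
        (δ i + δ j) / |V i - V j|)) := by
    intro i j hij
    have hne : i ≠ j := (Finset.mem_Ioi.1 hij).ne
    have h := abs_re_feynman_sub_le hm (hx' i j hne).1 (hx' i j hne).2 (L := 2 * μ)
      (ε := ε i + ε j) (δ := δ i + δ j)
      (by rw [hsub1]; exact (hdist i j).1) (by rw [hsub2]; exact (hdist i j).2)
      ⟨add_pos (hε1 i).1 (hε1 j).1, by linarith [(hε1 i).2, (hε1 j).2]⟩
      ⟨add_pos (hδ1 i).1 (hδ1 j).1, by linarith [(hδ1 i).2, (hδ1 j).2]⟩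
    rw [hsub1, hsub2] at h
    have hss : |s i * s j| ≤ r ^ 2 := by
      rw [abs_mul, sq]
      exact mul_le_mul (hs i) (hs j) (abs_nonneg _) ((abs_nonneg _).trans (hs i))
    have h2 : |s i * s j * ((feynman m (x i - x j)).re - G i j)| ≤
        r ^ 2 * (Λ * ((ε i + ε j) / |U i - U j| + (δ i + δ j) / |V i - V j|)) := by
      rw [abs_mul]
      exact mul_le_mul hss h (abs_nonneg _) (sq_nonneg r)
    have := (abs_le.1 h2).1
    linarith
  have hsum : -∑ l, ∑ j ∈ Finset.Ioi l, s l * s j * (feynman m (x l - x j)).re ≤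
      -∑ i, ∑ j ∈ Finset.Ioi i, s i * s j * G i j + r ^ 2 * (Λ *
        (∑ i, ∑ j ∈ Finset.Ioi i, (ε i + ε j) / |U i - U j| +
          ∑ i, ∑ j ∈ Finset.Ioi i, (δ i + δ j) / |V i - V j|)) := by
    have := Finset.sum_le_sum fun i (_ : i ∈ Finset.univ) => Finset.sum_le_sum (herr i)
    simpa only [Finset.sum_add_distrib, Finset.sum_neg_distrib, ← Finset.mul_sum] using this
  have hcr := add_le_add (sum_sum_Ioi_inv_crowding_le U) (sum_sum_Ioi_inv_crowding_le V)
  have hcr' := mul_le_mul_of_nonneg_left (mul_le_mul_of_nonneg_left hcr hΛ) (sq_nonneg r)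
  -- Pairs are half of the full double sum minus its diagonal. With the full sum nonnegative, half
  -- the self energy remains, which turns `4π` into `8π`.
  have hpair := sum_sum_Ioi_of_symm (fun i j => s i * s j * G i j)
    (fun i j => by rw [hGsymm i j]; ring)
  have hselfsum := Finset.sum_le_sum fun i (_ : i ∈ Finset.univ) => hself i
  rw [← Finset.mul_sum, Finset.sum_add_distrib, ← Finset.mul_sum, Finset.sum_const,
    Finset.card_univ, Fintype.card_fin, nsmul_eq_mul] at hselfsum
  have e8 : r ^ 2 / (8 * π) = r ^ 2 * (1 / (4 * π)) / 2 := by field_simp; ring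
  rw [stabilityConstant, e8]
  refine hsum.trans ?_
  linarith

lemma norm_exp_neg_energy_le {m μ r : ℝ} (hm : 0 < m) (hμ : 0 < μ) {n : ℕ} {s : Fin n → ℝ}
    (hs : ∀ i, |s i| ≤ r) {x : Fin n → Spacetime} (hx : ∀ i, x i ∈ doubleCone μ)
    (hx' : ∀ i j, i ≠ j → x i - x j ∈ offLightCone) :
    ‖Complex.exp (-∑ l, ∑ j ∈ Finset.Ioi l, ((s l * s j : ℝ) : ℂ) * feynman m (x l - x j))‖ ≤
      Real.exp (n * stabilityConstant m μ r) *
        ∏ i, (crowding (fun i => (x i).1 + (x i).2) i *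
          crowding (fun i => (x i).1 - (x i).2) i) ^ (r ^ 2 / (8 * π)) := by
  rw [Complex.norm_exp, Complex.neg_re, Complex.re_sum]
  simp only [Complex.re_sum, Complex.re_ofReal_mul]
  refine (Real.exp_le_exp.2 (neg_energy_le hm hμ hs hx hx')).trans_eq ?_
  rw [Real.exp_add, Finset.mul_sum, Real.exp_sum]
  congr 1
  refine Finset.prod_congr rfl fun i _ => ?_
  rw [Real.rpow_def_of_pos (mul_pos (crowding_pos _ i) (crowding_pos _ i)),
    Real.log_mul (crowding_pos _ i).ne' (crowding_pos _ i).ne', mul_comm]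

/-! ### Integrals of products of crowdings -/

/-- The singular kernel `|w|⁻ᵇ`, infinite at the origin. -/
def singularKernel (b w : ℝ) : ℝ≥0∞ := ENNReal.ofReal |w| ^ (-b)

@[fun_prop]
lemma measurable_singularKernel (b : ℝ) : Measurable (singularKernel b) := measurable_singularity b

/-- The interaction of a point `u` with points `w₁, …, wₙ`, with normalization `N`. -/
def meanKernel (b : ℝ) (N : ℕ) {n : ℕ} (w : Fin n → ℝ) (u : ℝ) : ℝ≥0∞ :=
  1 + (N : ℝ≥0∞)⁻¹ * ∑ j, singularKernel b (u - w j)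

/-- The interaction of the `i`-th point with the later ones. -/
def laterKernel (b : ℝ) (N : ℕ) {n : ℕ} (w : Fin n → ℝ) (i : Fin n) : ℝ≥0∞ :=
  1 + (N : ℝ≥0∞)⁻¹ * ∑ j, if i < j then singularKernel b (w i - w j) else 0

/-- The interaction of the `i`-th point with the earlier ones. -/
def earlierKernel (b : ℝ) (N : ℕ) {n : ℕ} (w : Fin n → ℝ) (i : Fin n) : ℝ≥0∞ :=
  1 + (N : ℝ≥0∞)⁻¹ * ∑ j, if j < i then singularKernel b (w i - w j) else 0

lemma laterKernel_zero (b : ℝ) (N : ℕ) {n : ℕ} (w : Fin (n + 1) → ℝ) :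
    laterKernel b N w 0 = meanKernel b N (fun j => w j.succ) (w 0) := by
  rw [laterKernel, meanKernel, Fin.sum_univ_succ]
  simp [Fin.succ_pos]

lemma laterKernel_succ (b : ℝ) (N : ℕ) {n : ℕ} (w : Fin (n + 1) → ℝ) (i : Fin n) :
    laterKernel b N w i.succ = laterKernel b N (fun j => w j.succ) i := by
  rw [laterKernel, laterKernel, Fin.sum_univ_succ]
  simp

lemma earlierKernel_eq_rev (b : ℝ) (N : ℕ) {n : ℕ} (w : Fin n → ℝ) (i : Fin n) :
    earlierKernel b N w i = laterKernel b N (fun j => w (Fin.rev j)) (Fin.rev i) := by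
  rw [earlierKernel, laterKernel, ← Equiv.sum_comp Fin.revPerm]
  simp only [Fin.revPerm_apply, Fin.rev_rev]
  congr 2
  exact Finset.sum_congr rfl fun j _ => by simp only [Fin.rev_lt_iff (i := j)]

lemma ennreal_sum_rpow_le {ι : Type*} (t : Finset ι) (f : ι → ℝ≥0∞) {b : ℝ} (hb0 : 0 < b)
    (hb1 : b ≤ 1) : (∑ i ∈ t, f i) ^ b ≤ ∑ i ∈ t, f i ^ b := by
  classical
  induction t using Finset.induction_on with
  | empty => simp [hb0]
  | insert i t hi ih =>
    rw [Finset.sum_insert hi, Finset.sum_insert hi]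
    exact (ENNReal.rpow_add_le_add_rpow _ _ hb0.le hb1).trans (by gcongr)

/-- Subadditivity of `t ↦ tᵇ` for `b ≤ 1` gives at most `n + S + T`, with `S` and `T` the sums over
earlier and later points, and `n + S + T ≤ n (1 + S/n)(1 + T/n)`. -/
theorem ofReal_crowding_rpow_le {b : ℝ} (hb0 : 0 < b) (hb1 : b ≤ 1) {n : ℕ} (w : Fin n → ℝ)
    (i : Fin n) :
    ENNReal.ofReal (crowding w i) ^ b ≤ n * (earlierKernel b n w i * laterKernel b n w i) := by
  have hn1 : 1 ≤ n := i.pos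
  have hn0 : (n : ℝ≥0∞) ≠ 0 := by exact_mod_cast (by omega : n ≠ 0)
  have hnt : (n : ℝ≥0∞) ≠ ⊤ := ENNReal.natCast_ne_top n
  have hkey : ∀ j, ENNReal.ofReal |w i - w j|⁻¹ ^ b ≤
      (if j < i then singularKernel b (w i - w j) else 0) +
        if i < j then singularKernel b (w i - w j) else 0 := by
    intro j
    have hker : ENNReal.ofReal |w i - w j|⁻¹ ^ b ≤ singularKernel b (w i - w j) := by
      rcases eq_or_ne (w i - w j) 0 with h | h
      · simp [h, hb0]
      · rw [singularKernel, ENNReal.ofReal_inv_of_pos (abs_pos.2 h), ENNReal.inv_rpow,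
          ENNReal.rpow_neg]
    rcases lt_trichotomy i j with h | h | h
    · simpa [h, h.not_gt] using hker
    · subst h
      simp [hb0]
    · simpa [h, h.not_gt] using hker
  have h1 : ENNReal.ofReal (crowding w i) ^ b ≤ n +
      ((∑ j, if j < i then singularKernel b (w i - w j) else 0) +
        ∑ j, if i < j then singularKernel b (w i - w j) else 0) := by
    rw [crowding, ENNReal.ofReal_add (by positivity)
      (Finset.sum_nonneg fun j _ => by positivity), ENNReal.ofReal_natCast,
      ENNReal.ofReal_sum_of_nonneg fun j _ => by positivity]
    refine (ENNReal.rpow_add_le_add_rpow _ _ hb0.le hb1).trans (add_le_add ?_ ?_)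
    · refine (ENNReal.rpow_le_rpow_of_exponent_le (by exact_mod_cast hn1) hb1).trans_eq ?_
      rw [ENNReal.rpow_one]
    · rw [← Finset.sum_add_distrib]
      exact (ennreal_sum_rpow_le _ _ hb0 hb1).trans (Finset.sum_le_sum fun j _ => hkey j)
  refine h1.trans ?_
  rw [earlierKernel, laterKernel]
  set S := ∑ j, if j < i then singularKernel b (w i - w j) else 0
  set T := ∑ j, if i < j then singularKernel b (w i - w j) else 0
  have e : (n : ℝ≥0∞) * ((1 + (n : ℝ≥0∞)⁻¹ * S) * (1 + (n : ℝ≥0∞)⁻¹ * T)) =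
      n + ((n * (n : ℝ≥0∞)⁻¹) * S + (n * (n : ℝ≥0∞)⁻¹) * T) +
        (n * (n : ℝ≥0∞)⁻¹) * S * ((n : ℝ≥0∞)⁻¹ * T) := by ring
  rw [e, ENNReal.mul_inv_cancel hn0 hnt, one_mul, one_mul]
  exact le_self_add

/-- A bound of the integral of `|u - w|⁻ᵇ` over `[-μ, μ]`, uniform in `w`. -/
def kernelMass (b μ : ℝ) : ℝ≥0∞ :=
  (∫⁻ w in Icc (-1) 1, singularKernel b w) + ENNReal.ofReal (2 * μ)

lemma setLIntegral_singularKernel_sub_le {b : ℝ} (hb0 : 0 < b) (μ w : ℝ) :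
    ∫⁻ u in Icc (-μ) μ, singularKernel b (u - w) ≤ kernelMass b μ := by
  -- Beyond distance 1 the kernel is at most 1, so only a fixed neighbourhood of the singularity
  -- needs integrability.
  have h1 : ∀ v, singularKernel b v ≤ (Icc (-1 : ℝ) 1).indicator (singularKernel b) v + 1 := by
    intro v
    by_cases hv : v ∈ Icc (-1 : ℝ) 1
    · rw [indicator_of_mem hv]
      exact le_self_add
    · rw [indicator_of_notMem hv, zero_add, singularKernel, ENNReal.rpow_neg, ENNReal.inv_le_one]
      refine ENNReal.one_le_rpow ?_ hb0
      rw [ENNReal.one_le_ofReal]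
      by_contra h
      exact hv (abs_le.1 (not_le.1 h).le)
  calc _ ≤ ∫⁻ u in Icc (-μ) μ, ((Icc (-1 : ℝ) 1).indicator (singularKernel b) (u - w) + 1) :=
        lintegral_mono fun u => h1 _
    _ = (∫⁻ u in Icc (-μ) μ, (Icc (-1 : ℝ) 1).indicator (singularKernel b) (u - w)) +
          ENNReal.ofReal (2 * μ) := by
        rw [lintegral_add_right _ measurable_const, lintegral_const, one_mul,
          Measure.restrict_apply_univ, Real.volume_Icc]
        congr 2
        ring
    _ ≤ (∫⁻ u, (Icc (-1 : ℝ) 1).indicator (singularKernel b) (u - w)) +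
          ENNReal.ofReal (2 * μ) := by
        gcongr
        exact Measure.restrict_le_self
    _ = _ := by
        rw [lintegral_sub_right_eq_self ((Icc (-1 : ℝ) 1).indicator (singularKernel b)) w,
          lintegral_indicator measurableSet_Icc, kernelMass]

lemma measurable_meanKernel (b : ℝ) (N : ℕ) {n : ℕ} (w : Fin n → ℝ) :
    Measurable (meanKernel b N w) := by
  unfold meanKernel
  fun_prop

/-- The normalization `1/N` absorbs the number `n ≤ N` of singularities. It has to stay fixed while
points are integrated out, hence two separate parameters. -/
lemma setLIntegral_meanKernel_le {b : ℝ} (hb0 : 0 < b) (μ : ℝ) {n N : ℕ} (hn : n ≤ N)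
    (w : Fin n → ℝ) :
    ∫⁻ u in Icc (-μ) μ, meanKernel b N w u ≤ ENNReal.ofReal (2 * μ) + kernelMass b μ := by
  simp only [meanKernel]
  rw [lintegral_add_left measurable_const, lintegral_const, one_mul, Measure.restrict_apply_univ,
    Real.volume_Icc, lintegral_const_mul _ (by fun_prop), lintegral_finsetSum _ (by fun_prop)]
  refine add_le_add (by rw [sub_neg_eq_add, two_mul]) ?_
  calc _ ≤ (N : ℝ≥0∞)⁻¹ * ∑ _j : Fin n, kernelMass b μ := by
        gcongr with j _
        exact setLIntegral_singularKernel_sub_le hb0 μ (w j)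
    _ = (N : ℝ≥0∞)⁻¹ * n * kernelMass b μ := by
        rw [Finset.sum_const, Finset.card_univ, Fintype.card_fin, nsmul_eq_mul, mul_assoc]
    _ ≤ (N : ℝ≥0∞)⁻¹ * N * kernelMass b μ := by gcongr
    _ ≤ 1 * kernelMass b μ := by
        gcongr
        exact ENNReal.inv_mul_le_one _
    _ = _ := one_mul _

lemma doubleCone_subset_lightConeBox (μ : ℝ) : doubleCone μ ⊆ lightConeBox μ :=
  fun _ hz => ⟨abs_le.2 ⟨hz.1.le, hz.2.1.le⟩, abs_le.2 ⟨hz.2.2.1.le, hz.2.2.2.le⟩⟩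

/-- The bound of the integral over the double cone of one interaction factor. -/
def coneMass (b μ : ℝ) : ℝ≥0∞ := (ENNReal.ofReal (2 * μ) + kernelMass b μ) ^ 2

lemma coneMass_ne_top {b : ℝ} (hb1 : b < 1) (μ : ℝ) : coneMass b μ ≠ ⊤ := by
  have := (lintegral_singularity_lt_top hb1 1).ne
  unfold coneMass kernelMass singularKernel
  finiteness

/-- The measure `dz` on the double cone. -/
abbrev coneMeasure (μ : ℝ) : Measure Spacetime := volume.restrict (doubleCone μ)

lemma lintegral_meanKernel_mul_le {b : ℝ} (hb0 : 0 < b) (μ : ℝ) {n N : ℕ} (hn : n ≤ N)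
    (w w' : Fin n → ℝ) :
    ∫⁻ z, meanKernel b N w (z.1 + z.2) * meanKernel b N w' (z.1 - z.2) ∂(coneMeasure μ) ≤
      coneMass b μ := by
  refine (lintegral_mono_set (doubleCone_subset_lightConeBox μ)).trans
    ((setLIntegral_lightConeBox_mul_le (measurable_meanKernel b N w)
      (measurable_meanKernel b N w') μ).trans ?_)
  rw [coneMass, sq]
  exact mul_le_mul' (setLIntegral_meanKernel_le hb0 μ hn w) (setLIntegral_meanKernel_le hb0 μ hn w')

@[fun_prop]
lemma measurable_laterKernel (b : ℝ) (N : ℕ) {n : ℕ} (i : Fin n) :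
    Measurable fun w : Fin n → ℝ => laterKernel b N w i := by
  unfold laterKernel
  refine Measurable.const_add (Measurable.const_mul (Finset.measurable_fun_sum _ fun j _ => ?_) _) _
  split_ifs
  · fun_prop
  · exact measurable_const

/-- The point with index 0 is later than no other and occurs only in its own factor. Integrating it
out costs one `coneMass`, uniformly in the other points, and leaves the same problem with one point
fewer. -/
lemma lintegral_prod_laterKernel_le {b : ℝ} (hb0 : 0 < b) (μ : ℝ) (N : ℕ) :
    ∀ n ≤ N, ∫⁻ x : Fin n → Spacetime,
      ∏ i, laterKernel b N (fun j => (x j).1 + (x j).2) i *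
        laterKernel b N (fun j => (x j).1 - (x j).2) i ∂(Measure.pi fun _ => coneMeasure μ) ≤
      coneMass b μ ^ n := by
  intro n
  induction n with
  | zero =>
    intro _
    simp
  | succ n ih =>
    intro hn
    have hmp := (measurePreserving_piFinSuccAbove (fun _ : Fin (n + 1) => coneMeasure μ) 0).symm
    rw [← hmp.lintegral_comp_emb (MeasurableEquiv.measurableEmbedding _)]
    rw [lintegral_prod_symm _ (by
      refine Measurable.aemeasurable ?_
      fun_prop)]
    simp only [Fin.prod_univ_succ, laterKernel_zero, laterKernel_succ]
    have hcons : ∀ (z : Spacetime) (y : Fin n → Spacetime),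
        (MeasurableEquiv.piFinSuccAbove (fun _ : Fin (n + 1) => Spacetime) 0).symm (z, y) =
          Fin.cons z y := fun z y => by
      simp [MeasurableEquiv.piFinSuccAbove, Fin.insertNthEquiv]
    simp only [hcons, Fin.cons_zero, Fin.cons_succ]
    calc _ = ∫⁻ y : Fin n → Spacetime,
          (∫⁻ z, meanKernel b N (fun j => (y j).1 + (y j).2) (z.1 + z.2) *
            meanKernel b N (fun j => (y j).1 - (y j).2) (z.1 - z.2) ∂(coneMeasure μ)) *
          ∏ i, laterKernel b N (fun j => (y j).1 + (y j).2) i *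
            laterKernel b N (fun j => (y j).1 - (y j).2) i ∂(Measure.pi fun _ => coneMeasure μ) := by
          refine lintegral_congr fun y => ?_
          have h1 := measurable_meanKernel b N fun j => (y j).1 + (y j).2
          have h2 := measurable_meanKernel b N fun j => (y j).1 - (y j).2
          rw [lintegral_mul_const _ (by fun_prop)]
      _ ≤ ∫⁻ y : Fin n → Spacetime, coneMass b μ *
          ∏ i, laterKernel b N (fun j => (y j).1 + (y j).2) i *
            laterKernel b N (fun j => (y j).1 - (y j).2) i ∂(Measure.pi fun _ => coneMeasure μ) := by
          gcongr with y
          exact lintegral_meanKernel_mul_le hb0 μ (by omega) _ _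
      _ ≤ _ := by
          rw [lintegral_const_mul _ (by fun_prop), pow_succ']
          gcongr
          exact ih (by omega)

/-- Reversing the order of the points turns earlier into later and preserves the product measure. -/
lemma lintegral_prod_earlierKernel_le {b : ℝ} (hb0 : 0 < b) (μ : ℝ) (n : ℕ) :
    ∫⁻ x : Fin n → Spacetime,
      ∏ i, earlierKernel b n (fun j => (x j).1 + (x j).2) i *
        earlierKernel b n (fun j => (x j).1 - (x j).2) i ∂(Measure.pi fun _ => coneMeasure μ) ≤
      coneMass b μ ^ n := by
  refine le_of_eq_of_le ?_ (lintegral_prod_laterKernel_le hb0 μ n n le_rfl)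
  have hmp := measurePreserving_piCongrLeft (fun _ : Fin n => coneMeasure μ) Fin.revPerm
  rw [← hmp.lintegral_comp_emb (MeasurableEquiv.measurableEmbedding _)]
  refine lintegral_congr fun x => ?_
  have hrev : ∀ j, (MeasurableEquiv.piCongrLeft (fun _ : Fin n => Spacetime) Fin.revPerm) x
      (Fin.rev j) = x j := fun j => Equiv.piCongrLeft_apply_apply (fun _ => Spacetime) Fin.revPerm x j
  simp only [earlierKernel_eq_rev, hrev]
  rw [← Equiv.prod_comp Fin.revPerm]
  simp

@[fun_prop]
lemma measurable_earlierKernel (b : ℝ) (N : ℕ) {n : ℕ} (i : Fin n) :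
    Measurable fun w : Fin n → ℝ => earlierKernel b N w i := by
  unfold earlierKernel
  refine Measurable.const_add (Measurable.const_mul (Finset.measurable_fun_sum _ fun j _ => ?_) _) _
  split_ifs
  · fun_prop
  · exact measurable_const

/-- The integral over the `n`-th power of the double cone of the product of the crowdings. -/
theorem lintegral_prod_crowding_le {b : ℝ} (hb0 : 0 < b) (hb1 : b ≤ 1) (μ : ℝ) (n : ℕ) :
    ∫⁻ x : Fin n → Spacetime,
      ∏ i, (ENNReal.ofReal (crowding (fun j => (x j).1 + (x j).2) i) ^ (b / 2) *
        ENNReal.ofReal (crowding (fun j => (x j).1 - (x j).2) i) ^ (b / 2))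
          ∂(Measure.pi fun _ => coneMeasure μ) ≤
      (n : ℝ≥0∞) ^ n * coneMass b μ ^ n := by
  set P : (Fin n → Spacetime) → ℝ≥0∞ := fun x =>
    ∏ i, earlierKernel b n (fun j => (x j).1 + (x j).2) i *
      earlierKernel b n (fun j => (x j).1 - (x j).2) i with hP
  set Q : (Fin n → Spacetime) → ℝ≥0∞ := fun x =>
    ∏ i, laterKernel b n (fun j => (x j).1 + (x j).2) i *
      laterKernel b n (fun j => (x j).1 - (x j).2) i with hQ
  have hPm : Measurable P := by fun_prop
  have hQm : Measurable Q := by fun_prop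
  have hhalf : ∀ c : ℝ≥0∞, c ^ (b / 2) = (c ^ b) ^ (1 / 2 : ℝ) := fun c => by
    rw [← ENNReal.rpow_mul]
    congr 1
    ring
  have hpt : ∀ x : Fin n → Spacetime,
      ∏ i, (ENNReal.ofReal (crowding (fun j => (x j).1 + (x j).2) i) ^ (b / 2) *
        ENNReal.ofReal (crowding (fun j => (x j).1 - (x j).2) i) ^ (b / 2)) ≤
      (n : ℝ≥0∞) ^ n * (P x ^ (1 / 2 : ℝ) * Q x ^ (1 / 2 : ℝ)) := by
    intro x
    calc _ ≤ ∏ i, (((n : ℝ≥0∞) * (earlierKernel b n (fun j => (x j).1 + (x j).2) i *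
            laterKernel b n (fun j => (x j).1 + (x j).2) i)) ^ (1 / 2 : ℝ) *
          ((n : ℝ≥0∞) * (earlierKernel b n (fun j => (x j).1 - (x j).2) i *
            laterKernel b n (fun j => (x j).1 - (x j).2) i)) ^ (1 / 2 : ℝ)) := by
          gcongr with i _
          · rw [hhalf]
            gcongr
            exact ofReal_crowding_rpow_le hb0 hb1 _ i
          · rw [hhalf]
            gcongr
            exact ofReal_crowding_rpow_le hb0 hb1 _ i
      _ = ∏ i, (n * ((earlierKernel b n (fun j => (x j).1 + (x j).2) i *
            earlierKernel b n (fun j => (x j).1 - (x j).2) i) *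
          (laterKernel b n (fun j => (x j).1 + (x j).2) i *
            laterKernel b n (fun j => (x j).1 - (x j).2) i)) ^ (1 / 2 : ℝ)) := by
          refine Finset.prod_congr rfl fun i _ => ?_
          have hh : (0 : ℝ) ≤ 1 / 2 := by norm_num
          have hn2 : (n : ℝ≥0∞) = (n : ℝ≥0∞) ^ (1 / 2 : ℝ) * (n : ℝ≥0∞) ^ (1 / 2 : ℝ) := by
            rw [← ENNReal.rpow_add_of_nonneg _ _ hh hh]
            norm_num
          conv_rhs => rw [hn2]
          simp only [ENNReal.mul_rpow_of_nonneg _ _ hh]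
          ring
      _ = _ := by
          rw [Finset.prod_mul_distrib, Finset.prod_const, Finset.card_univ, Fintype.card_fin,
            ENNReal.prod_rpow_of_nonneg (by norm_num), Finset.prod_mul_distrib,
            ENNReal.mul_rpow_of_nonneg _ _ (by norm_num)]
  -- The products over earlier and later points share all variables. Cauchy-Schwarz separates them,
  -- and its square roots are why the crowdings enter with exponent `b/2` only.
  have hCS : ∫⁻ x, P x ^ (1 / 2 : ℝ) * Q x ^ (1 / 2 : ℝ) ∂(Measure.pi fun _ => coneMeasure μ) ≤
      coneMass b μ ^ n := by
    have h := ENNReal.lintegral_mul_le_Lp_mul_Lq (Measure.pi fun _ : Fin n => coneMeasure μ)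
      Real.HolderConjugate.two_two (hPm.pow_const (1 / 2 : ℝ)).aemeasurable
      (hQm.pow_const (1 / 2 : ℝ)).aemeasurable
    have hsq : ∀ c : ℝ≥0∞, (c ^ (1 / 2 : ℝ)) ^ (2 : ℝ) = c := fun c => by
      rw [← ENNReal.rpow_mul]; norm_num
    simp only [Pi.mul_apply, hsq] at h
    refine h.trans ?_
    calc _ ≤ (coneMass b μ ^ n) ^ (1 / 2 : ℝ) * (coneMass b μ ^ n) ^ (1 / 2 : ℝ) := by
          gcongr
          · exact lintegral_prod_earlierKernel_le hb0 μ n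
          · exact lintegral_prod_laterKernel_le hb0 μ n n le_rfl
      _ = _ := by
          rw [← ENNReal.rpow_add_of_nonneg _ _ (by norm_num) (by norm_num)]
          norm_num
  calc _ ≤ ∫⁻ x, (n : ℝ≥0∞) ^ n * (P x ^ (1 / 2 : ℝ) * Q x ^ (1 / 2 : ℝ))
        ∂(Measure.pi fun _ => coneMeasure μ) := lintegral_mono hpt
    _ = (n : ℝ≥0∞) ^ n * ∫⁻ x, P x ^ (1 / 2 : ℝ) * Q x ^ (1 / 2 : ℝ)
        ∂(Measure.pi fun _ => coneMeasure μ) := lintegral_const_mul _ (by fun_prop)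
    _ ≤ _ := by gcongr

/-! ### Norms of products and measurability of the integrands -/

lemma enorm_finsetProd {𝕜 ι : Type*} [NormedField 𝕜] (t : Finset ι) (f : ι → 𝕜) :
    ‖∏ i ∈ t, f i‖ₑ = ∏ i ∈ t, ‖f i‖ₑ := by
  simp only [← ofReal_norm, norm_prod]
  exact ENNReal.ofReal_prod_of_nonneg fun i _ => norm_nonneg _

lemma lintegral_pi_prod_eq_pow {α : Type*} [MeasurableSpace α] (ν : Measure α) [SigmaFinite ν]
    {h : α → ℝ≥0∞} (hh : Measurable h) (n : ℕ) :
    ∫⁻ x : Fin n → α, ∏ i, h (x i) ∂(Measure.pi fun _ => ν) = (∫⁻ z, h z ∂ν) ^ n := by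
  induction n with
  | zero => simp
  | succ n ih =>
    have hmp := (measurePreserving_piFinSuccAbove (fun _ : Fin (n + 1) => ν) 0).symm
    rw [← hmp.lintegral_comp_emb (MeasurableEquiv.measurableEmbedding _)]
    have hcons : ∀ y : α × (Fin n → α),
        (MeasurableEquiv.piFinSuccAbove (fun _ : Fin (n + 1) => α) 0).symm y =
          Fin.cons y.1 y.2 := fun y => by
      simp [MeasurableEquiv.piFinSuccAbove, Fin.insertNthEquiv]
    simp only [hcons, Fin.prod_univ_succ, Fin.cons_zero, Fin.cons_succ]
    rw [lintegral_prod_mul hh.aemeasurable (g := fun y : Fin n → α => ∏ i, h (y i))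
      (Finset.measurable_fun_prod _ fun i _ => hh.comp (measurable_pi_apply i)).aemeasurable, ih,
      pow_succ']

lemma eLpNorm_pi_prod_le {α : Type*} [MeasurableSpace α] (ν : Measure α) [SigmaFinite ν]
    {g : α → ℝ} (hg : Measurable g) {q : ℝ≥0∞} (hq : 1 ≤ q) (n : ℕ) :
    eLpNorm (fun x : Fin n → α => ∏ i, g (x i)) q (Measure.pi fun _ => ν) ≤ eLpNorm g q ν ^ n := by
  rcases eq_or_ne q ⊤ with rfl | hqt
  · rw [eLpNorm_exponent_top, eLpNorm_exponent_top]
    refine essSup_le_of_ae_le _ ?_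
    have h1 : ∀ i : Fin n, ∀ᵐ x ∂(Measure.pi fun _ : Fin n => ν),
        ‖g (x i)‖ₑ ≤ eLpNormEssSup g ν := fun i =>
      (Measure.quasiMeasurePreserving_eval (fun _ : Fin n => ν) i).ae
        (enorm_ae_le_eLpNormEssSup g ν)
    filter_upwards [ae_all_iff.2 h1] with x hx
    rw [enorm_finsetProd]
    refine (Finset.prod_le_prod' fun i _ => hx i).trans_eq ?_
    simp
  · have hq0 : q ≠ 0 := (one_pos.trans_le hq).ne'
    rw [eLpNorm_eq_lintegral_rpow_enorm_toReal hq0 hqt, eLpNorm_eq_lintegral_rpow_enorm_toReal hq0 hqt,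
      ← ENNReal.rpow_natCast, ← ENNReal.rpow_mul, mul_comm, ENNReal.rpow_mul, ENNReal.rpow_natCast,
      ← lintegral_pi_prod_eq_pow ν (by fun_prop)]
    refine le_of_eq ?_
    congr 1
    refine lintegral_congr fun x => ?_
    rw [enorm_finsetProd, ENNReal.prod_rpow_of_nonneg ENNReal.toReal_nonneg]

/-- Configurations of points with pairwise non-lightlike separation. -/
def separatedConfigurations (n : ℕ) : Set (Fin n → Spacetime) :=
  {x | ∀ i j, i ≠ j → x i - x j ∈ offLightCone}

lemma ae_mem_separatedConfigurations (n : ℕ) :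
    ∀ᵐ x : Fin n → Spacetime, x ∈ separatedConfigurations n := by
  simp only [separatedConfigurations, mem_ofPred_eq]
  refine ae_all_iff.2 fun i => ae_all_iff.2 fun j => ?_
  by_cases hij : i = j
  · exact Eventually.of_forall fun x h => (h hij).elim
  have h1 := ae_linearMap_ne_zero (volume : Measure (Fin n → Spacetime))
    ((LinearMap.fst ℝ ℝ ℝ + LinearMap.snd ℝ ℝ ℝ) ∘ₗ (LinearMap.proj (R := ℝ) (φ := fun _ : Fin n => ℝ × ℝ) i - LinearMap.proj j))
    (fun h => by
      have := LinearMap.congr_fun h (Pi.single i (1, 0))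
      simp [Ne.symm hij] at this)
  have h2 := ae_linearMap_ne_zero (volume : Measure (Fin n → Spacetime))
    ((LinearMap.fst ℝ ℝ ℝ - LinearMap.snd ℝ ℝ ℝ) ∘ₗ (LinearMap.proj (R := ℝ) (φ := fun _ : Fin n => ℝ × ℝ) i - LinearMap.proj j))
    (fun h => by
      have := LinearMap.congr_fun h (Pi.single i (1, 0))
      simp [Ne.symm hij] at this)
  filter_upwards [h1, h2] with x hx1 hx2 _
  exact ⟨by simpa using hx1, by simpa using hx2⟩

lemma measurable_indicator_feynman {m : ℝ} (hm : 0 < m) :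
    Measurable (offLightCone.indicator (feynman m)) := by
  have h := measurable_indicator_twoPoint hm
  have e : offLightCone.indicator (feynman m) = fun z => if 0 ≤ z.1 then
      offLightCone.indicator (twoPoint m) z else
        offLightCone.indicator (twoPoint m) (-z.1, z.2) := by
    ext z
    have hmem : ((-z.1, z.2) : Spacetime) ∈ offLightCone ↔ z ∈ offLightCone := by
      simp only [offLightCone, mem_ofPred_eq]
      constructor
      · rintro ⟨h1, h2⟩
        exact ⟨fun h => h2 (by linarith), fun h => h1 (by linarith)⟩
      · rintro ⟨h1, h2⟩
        exact ⟨fun h => h2 (by linarith), fun h => h1 (by linarith)⟩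
    by_cases hz : z ∈ offLightCone
    · rw [indicator_of_mem hz, indicator_of_mem hz, indicator_of_mem (hmem.2 hz), feynman]
    · rw [indicator_of_notMem hz, indicator_of_notMem hz,
        indicator_of_notMem fun h' => hz (hmem.1 h')]
      simp
  rw [e]
  exact Measurable.ite (measurableSet_le measurable_const measurable_fst) h
    (h.comp (by fun_prop))

/-- The exceptional set depends on the points alone, so one jointly measurable version serves both
each fixed `s` and the integral over `s` and `x` together. -/
lemma exists_measurable_eq_vertexIntegrand {m : ℝ} (hm : 0 < m) {g φ : Spacetime → ℝ}
    (hg : Measurable g) (hφ : Measurable φ) (n : ℕ) :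
    ∃ Ψ : (Fin n → ℝ) × (Fin n → Spacetime) → ℂ, Measurable Ψ ∧
      ∀ s, ∀ x ∈ separatedConfigurations n, vertexIntegrand m g φ s x = Ψ (s, x) := by
  have hF := measurable_indicator_feynman hm
  refine ⟨fun y => (∏ i, Complex.exp (Complex.I * ((y.1 i * φ (y.2 i) : ℝ) : ℂ))) *
    Complex.exp (-∑ l, ∑ j ∈ Finset.Ioi l,
      ((y.1 l * y.1 j : ℝ) : ℂ) * offLightCone.indicator (feynman m) (y.2 l - y.2 j)) *
    ∏ i, ((g (y.2 i) : ℝ) : ℂ), by fun_prop, fun s x hx => ?_⟩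
  rw [vertexIntegrand]
  congr 3
  refine congrArg _ (Finset.sum_congr rfl fun l _ => Finset.sum_congr rfl fun j hj => ?_)
  rw [indicator_of_mem (hx l j (Finset.mem_Ioi.1 hj).ne)]

lemma aestronglyMeasurable_vertexIntegrand {m : ℝ} (hm : 0 < m) {g φ : Spacetime → ℝ}
    (hg : Measurable g) (hφ : Measurable φ) {n : ℕ} (s : Fin n → ℝ) :
    AEStronglyMeasurable (vertexIntegrand m g φ s) volume := by
  obtain ⟨Ψ, hΨ, h⟩ := exists_measurable_eq_vertexIntegrand hm hg hφ n
  refine (hΨ.comp (measurable_const.prodMk measurable_id) :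
    Measurable fun x => Ψ (s, x)).aestronglyMeasurable.congr ?_
  filter_upwards [ae_mem_separatedConfigurations n] with x hx
  exact (h s x hx).symm

lemma ae_prod_mem_separatedConfigurations (n : ℕ) :
    ∀ᵐ y : (Fin n → ℝ) × (Fin n → Spacetime), y.2 ∈ separatedConfigurations n :=
  Measure.quasiMeasurePreserving_snd.ae (ae_mem_separatedConfigurations n)

lemma aestronglyMeasurable_uncurry_vertexIntegrand {m : ℝ} (hm : 0 < m) {g φ : Spacetime → ℝ}
    (hg : Measurable g) (hφ : Measurable φ) (n : ℕ) :
    AEStronglyMeasurable (fun y : (Fin n → ℝ) × (Fin n → Spacetime) =>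
      vertexIntegrand m g φ y.1 y.2) volume := by
  obtain ⟨Ψ, hΨ, h⟩ := exists_measurable_eq_vertexIntegrand hm hg hφ n
  refine hΨ.aestronglyMeasurable.congr ?_
  filter_upwards [ae_prod_mem_separatedConfigurations n] with y hy
  exact (h y.1 y.2 hy).symm

/-! ### The majorant of the integrand and Hölder's inequality -/

/-- The bound of the interaction exponential by the crowdings of the light-cone coordinates. -/
def crowdingWeight (m μ r : ℝ) {n : ℕ} (x : Fin n → Spacetime) : ℝ :=
  Real.exp (n * stabilityConstant m μ r) *
    ∏ i, (crowding (fun i => (x i).1 + (x i).2) i *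
      crowding (fun i => (x i).1 - (x i).2) i) ^ (r ^ 2 / (8 * π))

@[fun_prop]
lemma measurable_crowding {n : ℕ} (i : Fin n) : Measurable fun w : Fin n → ℝ => crowding w i := by
  unfold crowding
  fun_prop

lemma measurable_crowdingWeight (m μ r : ℝ) (n : ℕ) :
    Measurable fun x : Fin n → Spacetime => crowdingWeight m μ r x := by
  unfold crowdingWeight
  fun_prop

lemma crowdingWeight_nonneg (m μ r : ℝ) {n : ℕ} (x : Fin n → Spacetime) :
    0 ≤ crowdingWeight m μ r x :=
  mul_nonneg (Real.exp_pos _).le (Finset.prod_nonneg fun i _ =>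
    Real.rpow_nonneg (mul_pos (crowding_pos _ i) (crowding_pos _ i)).le _)

/-- The field contributes phases of modulus one. Stability applies inside the double cone; if some
point lies outside, a factor of `g` annihilates both sides. -/
lemma norm_vertexIntegrand_le {m μ r : ℝ} (hm : 0 < m) (hμ : 0 < μ) {g : Spacetime → ℝ}
    (hg : tsupport g ⊆ doubleCone μ) (φ : Spacetime → ℝ) {n : ℕ} {s : Fin n → ℝ}
    (hs : ∀ i, |s i| ≤ r) {x : Fin n → Spacetime} (hx : x ∈ separatedConfigurations n) :
    ‖vertexIntegrand m g φ s x‖ ≤ (∏ i, ‖g (x i)‖) * crowdingWeight m μ r x := by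
  have e : ‖vertexIntegrand m g φ s x‖ = ‖Complex.exp (-∑ l, ∑ j ∈ Finset.Ioi l,
      ((s l * s j : ℝ) : ℂ) * feynman m (x l - x j))‖ * ∏ i, ‖g (x i)‖ := by
    have h1 : ∀ t : ℝ, ‖Complex.exp (Complex.I * (t : ℂ))‖ = 1 := fun t => by
      rw [mul_comm, Complex.norm_exp_ofReal_mul_I]
    rw [vertexIntegrand, norm_mul, norm_mul, norm_prod, norm_prod]
    simp only [h1, Finset.prod_const_one, one_mul, Complex.norm_real]
  rw [e, mul_comm]
  by_cases hmem : ∀ i, x i ∈ doubleCone μ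
  · exact mul_le_mul_of_nonneg_left (norm_exp_neg_energy_le hm hμ hs hmem hx)
      (Finset.prod_nonneg fun i _ => norm_nonneg _)
  · push Not at hmem
    obtain ⟨i, hi⟩ := hmem
    have h0 : ∏ i, ‖g (x i)‖ = 0 := Finset.prod_eq_zero (Finset.mem_univ i) (by
      rw [image_eq_zero_of_notMem_tsupport fun h => hi (hg h), norm_zero])
    rw [h0, zero_mul, zero_mul]

lemma enorm_crowdingWeight_rpow_le {m μ r b p : ℝ} (hp : 0 < p) (hpb : p * (r ^ 2 / (8 * π)) ≤ b / 2)
    {n : ℕ} (x : Fin n → Spacetime) :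
    ‖crowdingWeight m μ r x‖ₑ ^ p ≤ ENNReal.ofReal (Real.exp (p * stabilityConstant m μ r)) ^ n *
      ∏ i, (ENNReal.ofReal (crowding (fun j => (x j).1 + (x j).2) i) ^ (b / 2) *
        ENNReal.ofReal (crowding (fun j => (x j).1 - (x j).2) i) ^ (b / 2)) := by
  have hcr : ∀ i, 0 < crowding (fun i => (x i).1 + (x i).2) i *
      crowding (fun i => (x i).1 - (x i).2) i := fun i =>
    mul_pos (crowding_pos _ i) (crowding_pos _ i)
  have h1 : ∀ (w : Fin n → ℝ) i, (1 : ℝ≥0∞) ≤ ENNReal.ofReal (crowding w i) := fun w i => by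
    rw [ENNReal.one_le_ofReal]; exact one_le_crowding w i
  rw [Real.enorm_of_nonneg (crowdingWeight_nonneg m μ r x), crowdingWeight,
    ENNReal.ofReal_mul (Real.exp_pos _).le, ENNReal.mul_rpow_of_nonneg _ _ hp.le,
    ENNReal.ofReal_prod_of_nonneg fun i _ => Real.rpow_nonneg (hcr i).le _,
    ← ENNReal.prod_rpow_of_nonneg hp.le]
  refine mul_le_mul' (le_of_eq ?_) (Finset.prod_le_prod' fun i _ => ?_)
  · rw [ENNReal.ofReal_rpow_of_pos (Real.exp_pos _), ← Real.exp_mul,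
      ← ENNReal.ofReal_pow (Real.exp_pos _).le, ← Real.exp_nat_mul]
    congr 2
    ring
  · rw [← ENNReal.ofReal_rpow_of_pos (hcr i), ENNReal.ofReal_mul (crowding_pos _ i).le,
      ← ENNReal.rpow_mul, ← ENNReal.mul_rpow_of_ne_top ENNReal.ofReal_ne_top ENNReal.ofReal_ne_top]
    -- Crowdings are at least one, so the exponent may be raised to `b / 2`.
    refine ENNReal.rpow_le_rpow_of_exponent_le (one_le_mul (h1 _ i) (h1 _ i)) ?_
    linarith

/-- The `L¹` majorant of the vertex integrands. -/
def vertexMajorant (m μ r : ℝ) (g : Spacetime → ℝ) (n : ℕ) : ℝ≥0∞ :=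
  ∫⁻ x : Fin n → Spacetime, (∏ i, ‖g (x i)‖ₑ) * ‖crowdingWeight m μ r x‖ₑ

lemma lintegral_cone_of_support {μ : ℝ} {g : Spacetime → ℝ} (hg : tsupport g ⊆ doubleCone μ)
    (n : ℕ) (H : (Fin n → Spacetime) → ℝ≥0∞) :
    ∫⁻ x : Fin n → Spacetime, (∏ i, ‖g (x i)‖ₑ) * H x =
      ∫⁻ x, (∏ i, ‖g (x i)‖ₑ) * H x ∂(Measure.pi fun _ => coneMeasure μ) := by
  rw [← Measure.restrict_pi_pi, ← volume_pi]
  refine (setLIntegral_eq_of_support_subset fun x hx i _ => ?_).symm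
  by_contra hi
  refine hx (mul_eq_zero_of_left (Finset.prod_eq_zero (Finset.mem_univ i) ?_) _)
  rw [image_eq_zero_of_notMem_tsupport fun h => hi (hg h), enorm_zero]

/-- Hölder with `∏ g(xᵢ)` in `L^q` and the crowding weight in `L^p` of the cone; the first norm
factorizes, the second is the crowding integral. -/
theorem vertexMajorant_le {m μ r b p : ℝ} {q : ℝ≥0∞} (hp : 1 ≤ p)
    (hpq : (ENNReal.ofReal p)⁻¹ + q⁻¹ = 1) (hb0 : 0 < b) (hb1 : b ≤ 1)
    (hpb : p * (r ^ 2 / (8 * π)) ≤ b / 2) {g : Spacetime → ℝ} (hgm : Measurable g)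
    (hg : tsupport g ⊆ doubleCone μ) (n : ℕ) :
    vertexMajorant m μ r g n ≤ eLpNorm g q volume ^ n *
      (ENNReal.ofReal (Real.exp (p * stabilityConstant m μ r)) ^ n *
        ((n : ℝ≥0∞) ^ n * coneMass b μ ^ n)) ^ (1 / p) := by
  have hp0 : 0 < p := one_pos.trans_le hp
  have hq1 : 1 ≤ q := by
    rw [← ENNReal.inv_le_one, ← hpq]
    exact le_add_self
  rw [vertexMajorant, lintegral_cone_of_support hg]
  set ν := Measure.pi fun _ : Fin n => coneMeasure μ
  have hHm := measurable_crowdingWeight m μ r n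
  have : ENNReal.HolderTriple q (ENNReal.ofReal p) 1 := ⟨by rw [add_comm, hpq, inv_one]⟩
  have hH := eLpNorm_smul_le_mul_eLpNorm (μ := ν) (p := q) (q := ENNReal.ofReal p) (r := 1)
    (f := fun x : Fin n → Spacetime => crowdingWeight m μ r x)
    (φ := fun x : Fin n → Spacetime => ∏ i, g (x i)) hHm.aestronglyMeasurable
    (by fun_prop : Measurable fun x : Fin n → Spacetime => ∏ i, g (x i)).aestronglyMeasurable
  rw [eLpNorm_one_eq_lintegral_enorm] at hH
  simp only [Pi.smul_apply', enorm_smul, enorm_finsetProd] at hH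
  refine hH.trans (mul_le_mul' ((eLpNorm_pi_prod_le _ hgm hq1 n).trans ?_) ?_)
  · gcongr
    exact Measure.restrict_le_self
  · rw [eLpNorm_eq_lintegral_rpow_enorm_toReal (by simpa using hp0) ENNReal.ofReal_ne_top,
      ENNReal.toReal_ofReal hp0.le]
    gcongr
    refine (lintegral_mono fun x => enorm_crowdingWeight_rpow_le hp0 hpb x).trans ?_
    rw [lintegral_const_mul _ (by fun_prop)]
    gcongr
    exact lintegral_prod_crowding_le hb0 hb1 μ n

lemma lintegral_enorm_vertexIntegrand_le {m μ r : ℝ} (hm : 0 < m) (hμ : 0 < μ)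
    {g : Spacetime → ℝ} (hg : tsupport g ⊆ doubleCone μ) (φ : Spacetime → ℝ) {n : ℕ}
    {s : Fin n → ℝ} (hs : ∀ i, |s i| ≤ r) :
    ∫⁻ x, ‖vertexIntegrand m g φ s x‖ₑ ≤ vertexMajorant m μ r g n := by
  refine lintegral_mono_ae ?_
  filter_upwards [ae_mem_separatedConfigurations n] with x hx
  have h := norm_vertexIntegrand_le hm hμ hg φ hs hx
  rw [← enorm_finsetProd, ← enorm_mul, enorm_le_iff_norm_le, norm_mul, norm_prod,
    Real.norm_of_nonneg (crowdingWeight_nonneg m μ r x)]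
  exact h

lemma stabilityConstant_nonneg {m μ r : ℝ} (hμ : 0 < μ) : 0 ≤ stabilityConstant m μ r := by
  have h1 := selfEnergyConstant_nonneg m
  have h2 := lipConstant_nonneg m (R := 4 + 2 * (2 * μ)) (by linarith)
  unfold stabilityConstant
  positivity

lemma lintegral_prod_mul_majorant {f : ℝ → ℂ} (hf : Measurable f) (m μ r : ℝ) {g : Spacetime → ℝ}
    (hg : Measurable g) (n : ℕ) :
    ∫⁻ y : (Fin n → ℝ) × (Fin n → Spacetime), (∏ i, ‖f (y.1 i)‖ₑ) *
      ((∏ i, ‖g (y.2 i)‖ₑ) * ‖crowdingWeight m μ r y.2‖ₑ) =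
      (∫⁻ s, ‖f s‖ₑ) ^ n * vertexMajorant m μ r g n := by
  have hH := measurable_crowdingWeight m μ r n
  rw [Measure.volume_eq_prod, lintegral_prod_mul (f := fun s : Fin n → ℝ => ∏ i, ‖f (s i)‖ₑ)
    (g := fun x : Fin n → Spacetime => (∏ i, ‖g (x i)‖ₑ) * ‖crowdingWeight m μ r x‖ₑ)
    (by fun_prop : Measurable _).aemeasurable (by fun_prop : Measurable _).aemeasurable,
    vertexMajorant, volume_pi,
    lintegral_pi_prod_eq_pow volume (h := fun s => ‖f s‖ₑ) (by fun_prop)]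

lemma enorm_timeOrderedPower_le {m μ r : ℝ} (hm : 0 < m) (hμ : 0 < μ) {f : ℝ → ℂ}
    (hf : Measurable f) (hfr : ∀ s, r < |s| → f s = 0) {g : Spacetime → ℝ}
    (hg : tsupport g ⊆ doubleCone μ) (n : ℕ) (φ : Spacetime → ℝ) :
    ‖timeOrderedPower m f g n φ‖ₑ ≤ (∫⁻ s, ‖f s‖ₑ) ^ n * vertexMajorant m μ r g n := by
  rw [← lintegral_pi_prod_eq_pow volume (by fun_prop : Measurable fun s => ‖f s‖ₑ), ← volume_pi,
    ← lintegral_mul_const _ (by fun_prop)]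
  refine (enorm_integral_le_lintegral_enorm _).trans (lintegral_mono fun s => ?_)
  rw [enorm_mul, enorm_finsetProd]
  by_cases hs : ∀ i, |s i| ≤ r
  · gcongr
    exact (enorm_integral_le_lintegral_enorm _).trans
      (lintegral_enorm_vertexIntegrand_le hm hμ hg φ hs)
  · push Not at hs
    obtain ⟨i, hi⟩ := hs
    have h0 : ∏ i, ‖f (s i)‖ₑ = 0 := Finset.prod_eq_zero (Finset.mem_univ i) (by
      rw [hfr _ hi, enorm_zero])
    simp only [h0, zero_mul, le_refl]

lemma vertexMajorant_ne_top {m μ r b : ℝ} (hb0 : 0 < b) (hb1 : b < 1)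
    (hb : r ^ 2 / (8 * π) ≤ b / 2) {g : Spacetime → ℝ} (hgc : Continuous g)
    (hgs : HasCompactSupport g) (hg : tsupport g ⊆ doubleCone μ) (n : ℕ) :
    vertexMajorant m μ r g n ≠ ⊤ := by
  have h1 : eLpNorm g ⊤ volume ≠ ⊤ := (hgc.memLp_of_hasCompactSupport hgs).eLpNorm_ne_top
  have h2 := coneMass_ne_top hb1 μ
  refine ne_top_of_le_ne_top ?_ (vertexMajorant_le (p := 1) (q := ⊤) le_rfl (by simp) hb0 hb1.le
    (by linarith) hgc.measurable hg n)
  rw [one_div_one, ENNReal.rpow_one]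
  finiteness

/-! ### Factorial bounds, summability and integrability -/

/-- The term `nⁿ/n!` of the exponential series at `n` is at most `eⁿ`. -/
lemma natCast_pow_self_le (n : ℕ) : (n : ℝ) ^ n ≤ Real.exp 1 ^ n * n.factorial := by
  have h := Real.pow_div_factorial_le_exp (n : ℝ) n.cast_nonneg n
  rw [div_le_iff₀ (by positivity)] at h
  rwa [← Real.exp_nat_mul, mul_one]

/-- The constant of the factorial estimate. -/
def factorialConstant (m μ r b P : ℝ) : ℝ :=
  Real.exp (P * stabilityConstant m μ r + 1) * ((coneMass b μ).toReal + 1)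

lemma factorialConstant_pos (m μ r b P : ℝ) : 0 < factorialConstant m μ r b P := by
  have : 0 ≤ (coneMass b μ).toReal := ENNReal.toReal_nonneg
  unfold factorialConstant
  positivity

/-- Replacing `p` by its upper bound `P` makes the constant independent of `p`; the added 1 in the
mass factor keeps it positive. -/
lemma majorant_le_factorial {m μ r b p P : ℝ} (hμ : 0 < μ) (hb1 : b < 1) (hpP : p ≤ P) (n : ℕ) :
    ENNReal.ofReal (Real.exp (p * stabilityConstant m μ r)) ^ n *
        ((n : ℝ≥0∞) ^ n * coneMass b μ ^ n) ≤
      ENNReal.ofReal (factorialConstant m μ r b P ^ n * n.factorial) := by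
  set M := (coneMass b μ).toReal
  have hM : 0 ≤ M := ENNReal.toReal_nonneg
  rw [← ENNReal.ofReal_toReal (coneMass_ne_top hb1 μ), ← ENNReal.ofReal_natCast n,
    ← ENNReal.ofReal_pow (Real.exp_pos _).le, ← ENNReal.ofReal_pow n.cast_nonneg,
    ← ENNReal.ofReal_pow hM, ← ENNReal.ofReal_mul (by positivity),
    ← ENNReal.ofReal_mul (by positivity)]
  apply ENNReal.ofReal_le_ofReal
  have h1 : Real.exp (p * stabilityConstant m μ r) ≤ Real.exp (P * stabilityConstant m μ r) :=
    Real.exp_le_exp.2 (mul_le_mul_of_nonneg_right hpP (stabilityConstant_nonneg hμ))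
  calc _ ≤ Real.exp (P * stabilityConstant m μ r) ^ n *
        ((Real.exp 1 ^ n * n.factorial) * (M + 1) ^ n) := by
        gcongr
        · exact natCast_pow_self_le n
        · linarith
    _ = _ := by
        rw [factorialConstant, Real.exp_add, mul_pow, mul_pow]
        ring

theorem norm_sCoeff_le {m μ r b p P : ℝ} {q : ℝ≥0∞} (hm : 0 < m) (hμ : 0 < μ) (hp : 1 ≤ p)
    (hpP : p ≤ P) (hpq : (ENNReal.ofReal p)⁻¹ + q⁻¹ = 1) (hb0 : 0 < b) (hb1 : b < 1)
    (hpb : p * (r ^ 2 / (8 * π)) ≤ b / 2) {f : ℝ → ℂ} (hf : Continuous f) (hfi : Integrable f)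
    (hfr : ∀ s, r < |s| → f s = 0) {g : Spacetime → ℝ} (hgc : Continuous g)
    (hgs : HasCompactSupport g) (hg : tsupport g ⊆ doubleCone μ) (n : ℕ) (φ : Spacetime → ℝ) :
    ‖sCoeff m f g n φ‖ ≤ (∫ s, ‖f s‖) ^ n / n.factorial * (eLpNorm g q volume).toReal ^ n *
      (factorialConstant m μ r b P ^ n * n.factorial) ^ (1 / p) := by
  have hC := factorialConstant_pos m μ r b P
  have hX : 0 ≤ factorialConstant m μ r b P ^ n * (n.factorial : ℝ) := by positivity
  have hgq : eLpNorm g q volume ≠ ⊤ := (hgc.memLp_of_hasCompactSupport hgs).eLpNorm_ne_top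
  have hfF : ∫⁻ s, ‖f s‖ₑ ≠ ⊤ := hfi.2.ne
  have hp0 : 0 ≤ 1 / p := by positivity
  have h1 : ‖timeOrderedPower m f g n φ‖ₑ ≤ (∫⁻ s, ‖f s‖ₑ) ^ n * (eLpNorm g q volume ^ n *
      ENNReal.ofReal (factorialConstant m μ r b P ^ n * n.factorial) ^ (1 / p)) := by
    refine (enorm_timeOrderedPower_le hm hμ hf.measurable hfr hg n φ).trans ?_
    gcongr
    refine (vertexMajorant_le hp hpq hb0 hb1.le hpb hgc.measurable hg n).trans ?_
    gcongr
    exact majorant_le_factorial hμ hb1 hpP n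
  have h2 := ENNReal.toReal_mono (by finiteness) h1
  rw [toReal_enorm, ENNReal.toReal_mul, ENNReal.toReal_mul, ENNReal.toReal_pow, ENNReal.toReal_pow,
    ← ENNReal.toReal_rpow, ENNReal.toReal_ofReal hX,
    ← integral_norm_eq_lintegral_enorm hfi.1] at h2
  rw [sCoeff, norm_mul, norm_div, norm_pow, Complex.norm_I, one_pow, Complex.norm_natCast]
  calc _ ≤ 1 / (n.factorial : ℝ) * _ := mul_le_mul_of_nonneg_left h2 (by positivity)
    _ = _ := by ring

lemma summable_pow_mul_factorial_rpow {p : ℝ} (hp : 1 < p) {x : ℝ} (hx : 0 ≤ x) :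
    Summable fun n : ℕ => x ^ n / n.factorial * (n.factorial : ℝ) ^ (1 / p) := by
  -- The ratio of consecutive terms is `y (n+1)^(1/p - 1)`, which tends to zero. The ratio test
  -- needs nonzero terms, so it is applied at `x + 1`.
  have key : ∀ y : ℝ, 0 < y →
      Summable fun n : ℕ => y ^ n / n.factorial * (n.factorial : ℝ) ^ (1 / p) := by
    intro y hy
    refine summable_of_ratio_test_tendsto_lt_one (l := 0) one_pos
      (Eventually.of_forall fun n => by positivity) ?_
    have hθ : 0 < 1 - 1 / p := by
      rw [sub_pos, div_lt_one (by linarith)]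
      exact hp
    have hlim : Tendsto (fun n : ℕ => y * ((n : ℝ) + 1) ^ (-(1 - 1 / p))) atTop (𝓝 0) := by
      have h1 := (tendsto_rpow_neg_atTop hθ).comp
        (tendsto_atTop_add_const_right atTop (1 : ℝ) tendsto_natCast_atTop_atTop)
      simpa using h1.const_mul y
    refine hlim.congr fun n => ?_
    have hn : (0 : ℝ) < (n : ℝ) + 1 := by positivity
    have hF : (0 : ℝ) < (n.factorial : ℝ) := by positivity
    rw [Real.norm_of_nonneg (by positivity), Real.norm_of_nonneg (by positivity),
      Nat.factorial_succ]
    push_cast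
    rw [Real.mul_rpow hn.le hF.le, neg_sub, Real.rpow_sub hn, Real.rpow_one, pow_succ]
    field_simp
  refine (key (x + 1) (by linarith)).of_nonneg_of_le (fun n => by positivity) fun n => ?_
  gcongr
  linarith

/-- The argument produces neither of these two factors. With `K = |log(2μ)|/(2π) + 1` the
exponential outweighs a possibly small power of `2μ`, so they can be inserted in the final estimate
for free. -/
lemma one_le_exp_mul_rpow {μ : ℝ} (hμ : 0 < μ) (a : ℝ) (n : ℕ) :
    1 ≤ Real.exp (n * ((|Real.log (2 * μ)| / (2 * π) + 1) / 2) * a ^ 2) *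
      (2 * μ) ^ ((n : ℝ) * (a ^ 2 / (4 * π))) := by
  rw [Real.rpow_def_of_pos (by linarith), ← Real.exp_add, Real.one_le_exp_iff]
  have h : 0 ≤ |Real.log (2 * μ)| + Real.log (2 * μ) := by linarith [neg_abs_le (Real.log (2 * μ))]
  have e : (n : ℝ) * ((|Real.log (2 * μ)| / (2 * π) + 1) / 2) * a ^ 2 +
      Real.log (2 * μ) * ((n : ℝ) * (a ^ 2 / (4 * π))) =
      n * a ^ 2 * ((|Real.log (2 * μ)| + Real.log (2 * μ)) / (4 * π) + 1 / 2) := by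
    field_simp
    ring
  rw [e]
  positivity

lemma integrable_vertexIntegrand {m μ a : ℝ} (hm : 0 < m) (hμ : 0 < μ) (ha : 0 < a)
    (ha4 : a ^ 2 < 4 * π) {g : Spacetime → ℝ} (hgc : Continuous g) (hgs : HasCompactSupport g)
    (hg : tsupport g ⊆ doubleCone μ) {φ : Spacetime → ℝ} (hφ : Measurable φ) {n : ℕ}
    {s : Fin n → ℝ} (hs : ∀ i, |s i| < a) : Integrable (vertexIntegrand m g φ s) volume := by
  obtain ⟨r, hr0, hra, hsr⟩ : ∃ r, 0 < r ∧ r < a ∧ ∀ i, |s i| ≤ r := by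
    -- Finitely many values below `a` have a maximum below `a`; including `a / 2` makes it positive
    -- and covers `n = 0`.
    have hfin : (insert (a / 2) (range fun i => |s i|)).Finite := (finite_range _).insert _
    obtain ⟨r, hr, hmax⟩ := hfin.exists_maximal (insert_nonempty _ _)
    have hle : ∀ t ∈ insert (a / 2) (range fun i => |s i|), t ≤ r := fun t ht =>
      (le_total t r).elim id fun h => hmax ht h
    refine ⟨r, (half_pos ha).trans_le (hle _ (mem_insert _ _)), ?_,
      fun i => hle _ (mem_insert_of_mem _ (mem_range_self i))⟩
    rcases hr with rfl | ⟨i, rfl⟩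
    · exact half_lt_self ha
    · exact hs i
  refine ⟨aestronglyMeasurable_vertexIntegrand hm hgc.measurable hφ s, ?_⟩
  have hb : r ^ 2 / (8 * π) ≤ (r ^ 2 / a ^ 2) / 2 := by
    rw [div_div]
    exact div_le_div_of_nonneg_left (sq_nonneg r) (by positivity) (by linarith)
  exact (lintegral_enorm_vertexIntegrand_le hm hμ hg φ hsr).trans_lt (vertexMajorant_ne_top
    (b := r ^ 2 / a ^ 2) (by positivity)
    ((div_lt_one (by positivity)).2 (pow_lt_pow_left₀ hra hr0.le two_ne_zero)) hb hgc hgs hg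
    n).lt_top

lemma integrable_prod_mul_vertexIntegrand {m μ r b : ℝ} (hm : 0 < m) (hμ : 0 < μ) (hb0 : 0 < b)
    (hb1 : b < 1) (hb : r ^ 2 / (8 * π) ≤ b / 2) {f : ℝ → ℂ} (hf : Continuous f)
    (hfi : Integrable f) (hfr : ∀ s, r < |s| → f s = 0) {g : Spacetime → ℝ} (hgc : Continuous g)
    (hgs : HasCompactSupport g) (hg : tsupport g ⊆ doubleCone μ) {φ : Spacetime → ℝ}
    (hφ : Measurable φ) (n : ℕ) :
    Integrable (fun y : (Fin n → ℝ) × (Fin n → Spacetime) =>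
      (∏ i, f (y.1 i)) * vertexIntegrand m g φ y.1 y.2) volume := by
  have hfm := hf.measurable
  refine ⟨(by fun_prop : Measurable fun y : (Fin n → ℝ) × (Fin n → Spacetime) =>
    ∏ i, f (y.1 i)).aestronglyMeasurable.mul
      (aestronglyMeasurable_uncurry_vertexIntegrand hm hgc.measurable hφ n), ?_⟩
  refine lt_of_le_of_lt (lintegral_mono_ae (g := fun y : (Fin n → ℝ) × (Fin n → Spacetime) =>
    (∏ i, ‖f (y.1 i)‖ₑ) * ((∏ i, ‖g (y.2 i)‖ₑ) * ‖crowdingWeight m μ r y.2‖ₑ)) ?_) ?_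
  · filter_upwards [ae_prod_mem_separatedConfigurations n] with y hy
    rw [enorm_mul, enorm_finsetProd]
    by_cases hs : ∀ i, |y.1 i| ≤ r
    · gcongr
      rw [← enorm_finsetProd, ← enorm_mul, enorm_le_iff_norm_le, norm_mul, norm_prod,
        Real.norm_of_nonneg (crowdingWeight_nonneg m μ r y.2)]
      exact norm_vertexIntegrand_le hm hμ hg φ hs hy
    · push Not at hs
      obtain ⟨i, hi⟩ := hs
      have h0 : ∏ i, ‖f (y.1 i)‖ₑ = 0 := Finset.prod_eq_zero (Finset.mem_univ i) (by
        rw [hfr _ hi, enorm_zero])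
      simp only [h0, zero_mul, le_refl]
  · rw [lintegral_prod_mul_majorant hfm m μ r hgc.measurable]
    exact ENNReal.mul_lt_top (ENNReal.pow_lt_top hfi.2)
      (vertexMajorant_ne_top hb0 hb1 hb hgc hgs hg n).lt_top

end

end SMatrix2D

theorem mainTheorem7 (m μ a : ℝ) (hm : 0 < m) (hμ : 0 < μ) (ha : 0 < a)
    (ha4 : a ^ 2 < 4 * Real.pi) :
    SMatrix2D.IsVacuumKernel m (SMatrix2D.twoPoint m) ∧
    ∀ r : ℝ, r < a → ∃ C K : ℝ, 0 < C ∧ 0 < K ∧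
      ∀ (f : ℝ → ℂ) (g : SMatrix2D.Spacetime → ℝ),
        ContDiff ℝ ∞ f → tsupport f ⊆ Set.Icc (-r) r →
        (∀ s, (starRingEnd ℂ) (f s) = f (-s)) →
        ContDiff ℝ ∞ g → HasCompactSupport g → tsupport g ⊆ SMatrix2D.doubleCone μ →
        -- the time-ordered products are given by absolutely convergent integrals
        (∀ φ ∈ SMatrix2D.Configurations, ∀ n : ℕ,
          (∀ s : Fin n → ℝ, (∀ i, |s i| < a) →
            Integrable (SMatrix2D.vertexIntegrand m g φ s) volume) ∧
          Integrable (fun y : (Fin n → ℝ) × (Fin n → SMatrix2D.Spacetime) =>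
            (∏ i, f (y.1 i)) * SMatrix2D.vertexIntegrand m g φ y.1 y.2) volume) ∧
        -- the estimate, uniformly in the field configuration
        (∀ (p : ℝ) (q : ℝ≥0∞), 1 ≤ p → p < 4 * Real.pi / a ^ 2 →
          (ENNReal.ofReal p)⁻¹ + q⁻¹ = 1 →
          ∀ n : ℕ, ∀ φ ∈ SMatrix2D.Configurations,
            ‖SMatrix2D.sCoeff m f g n φ‖ ≤
              (∫ s, ‖f s‖) ^ n / (n.factorial : ℝ) * Real.exp (n * (K / 2) * a ^ 2) *
                (2 * μ) ^ ((n : ℝ) * (a ^ 2 / (4 * Real.pi))) *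
                (eLpNorm g q volume).toReal ^ n *
                (C ^ n * (n.factorial : ℝ)) ^ (1 / p)) ∧
        -- absolute convergence for each configuration, uniformly over all of them
        (∀ lam : ℂ,
          (∀ φ ∈ SMatrix2D.Configurations,
            Summable fun n : ℕ => ‖lam ^ n * SMatrix2D.sCoeff m f g n φ‖) ∧
          TendstoUniformlyOn
            (fun (N : ℕ) (φ : SMatrix2D.Spacetime → ℝ) =>
              ∑ n ∈ Finset.range N, ‖lam ^ n * SMatrix2D.sCoeff m f g n φ‖)
            (fun φ => ∑' n : ℕ, ‖lam ^ n * SMatrix2D.sCoeff m f g n φ‖)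
            atTop SMatrix2D.Configurations ∧
          TendstoUniformlyOn
            (fun (N : ℕ) (φ : SMatrix2D.Spacetime → ℝ) =>
              ∑ n ∈ Finset.range N, lam ^ n * SMatrix2D.sCoeff m f g n φ)
            (fun φ => ∑' n : ℕ, lam ^ n * SMatrix2D.sCoeff m f g n φ)
            atTop SMatrix2D.Configurations) := by
  open SMatrix2D in
  refine ⟨isVacuumKernel_twoPoint hm, fun r hr => ?_⟩
  -- The maximum with `a / 2` keeps the radius positive, since `r` may be zero or negative.
  set R := max r (a / 2) with hR
  have hR0 : 0 < R := (half_pos ha).trans_le (le_max_right _ _)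
  have hRa : R < a := max_lt hr (half_lt_self ha)
  -- At the endpoint `p = 4π/a²` the exponent `p R²/(8π)` equals `b / 2`, so this `b < 1` serves
  -- every admissible `p`.
  set b := R ^ 2 / a ^ 2 with hb
  have hb0 : 0 < b := by positivity
  have hb1 : b < 1 := (div_lt_one (by positivity)).2 (pow_lt_pow_left₀ hRa hR0.le two_ne_zero)
  set P := 4 * Real.pi / a ^ 2 with hP
  have hP1 : 1 < P := (one_lt_div (by positivity)).2 ha4
  have hpb : ∀ p ≤ P, p * (R ^ 2 / (8 * Real.pi)) ≤ b / 2 := by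
    intro p hp
    refine (mul_le_mul_of_nonneg_right hp (by positivity)).trans_eq ?_
    rw [hP, hb]
    field_simp
    ring
  have hb8 : R ^ 2 / (8 * Real.pi) ≤ b / 2 := by simpa using hpb 1 hP1.le
  refine ⟨factorialConstant m μ R b P, |Real.log (2 * μ)| / (2 * Real.pi) + 1,
    factorialConstant_pos m μ R b P, by positivity, fun f g hfs hfr _ hgs hgc hg => ?_⟩
  have hf := hfs.continuous
  have hg' := hgs.continuous
  have hfi : Integrable f := hf.integrable_of_hasCompactSupport
    (isCompact_Icc.of_isClosed_subset (isClosed_tsupport f) hfr)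
  have hfR : ∀ s, R < |s| → f s = 0 := by
    intro s hs
    refine image_eq_zero_of_notMem_tsupport fun h => ?_
    have := abs_le.2 (hfr h)
    exact absurd (hs.trans_le this) (not_lt.2 (le_max_left _ _))
  refine ⟨fun φ hφ n => ?_, fun p q hp hpP hpq n φ _ => ?_, fun lam => ?_⟩
  · have hφ' : Measurable φ := (show ContDiff ℝ ∞ φ from hφ).continuous.measurable
    exact ⟨fun s hs => integrable_vertexIntegrand hm hμ ha ha4 hg' hgc hg hφ' hs,
      integrable_prod_mul_vertexIntegrand hm hμ hb0 hb1 hb8 hf hfi hfR hg' hgc hg hφ' n⟩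
  · refine (norm_sCoeff_le hm hμ hp hpP.le hpq hb0 hb1 (hpb p hpP.le) hf hfi hfR hg' hgc hg n
      φ).trans ?_
    have hC := factorialConstant_pos m μ R b P
    have hF : 0 ≤ ∫ s, ‖f s‖ := integral_nonneg fun s => norm_nonneg _
    have hE := one_le_exp_mul_rpow hμ a n
    calc _ ≤ ((∫ s, ‖f s‖) ^ n / n.factorial * (eLpNorm g q volume).toReal ^ n *
          (factorialConstant m μ R b P ^ n * n.factorial) ^ (1 / p)) * _ :=
          le_mul_of_one_le_right (by positivity) hE
      _ = _ := by ring
  -- The hypothesis `a² < 4π` leaves room for some `p > 1`; at `p = 1` the factorials would cancel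
  -- and leave a geometric series.
  · obtain ⟨p, hp1, hpP⟩ := exists_between hP1
    have hpc := Real.HolderConjugate.conjExponent hp1
    have hpq : (ENNReal.ofReal p)⁻¹ + (ENNReal.ofReal (Real.conjExponent p))⁻¹ = 1 := by
      rw [← ENNReal.ofReal_inv_of_pos hpc.pos, ← ENNReal.ofReal_inv_of_pos hpc.symm.pos,
        ← ENNReal.ofReal_add hpc.inv_nonneg hpc.symm.inv_nonneg, hpc.inv_add_inv_eq_one,
        ENNReal.ofReal_one]
    set C := factorialConstant m μ R b P
    have hC : 0 < C := factorialConstant_pos m μ R b P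
    set G := (eLpNorm g (ENNReal.ofReal (Real.conjExponent p)) volume).toReal
    have hF : 0 ≤ ∫ s, ‖f s‖ := integral_nonneg fun s => norm_nonneg _
    set Y := ‖lam‖ * (∫ s, ‖f s‖) * G * C ^ (1 / p)
    have hY : 0 ≤ Y := by positivity
    have hbound : ∀ n : ℕ, ∀ φ : Spacetime → ℝ, ‖lam ^ n * sCoeff m f g n φ‖ ≤
        Y ^ n / n.factorial * (n.factorial : ℝ) ^ (1 / p) := by
      intro n φ
      rw [norm_mul, norm_pow]
      refine (mul_le_mul_of_nonneg_left (norm_sCoeff_le hm hμ hp1.le hpP.le hpq hb0 hb1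
        (hpb p hpP.le) hf hfi hfR hg' hgc hg n φ) (by positivity)).trans_eq ?_
      rw [Real.mul_rpow (by positivity) (by positivity), ← Real.rpow_natCast C n,
        ← Real.rpow_mul hC.le, mul_comm (n : ℝ), Real.rpow_mul hC.le, Real.rpow_natCast]
      simp only [Y, G, mul_pow]
      ring
    have hsum := summable_pow_mul_factorial_rpow hp1 hY
    exact ⟨fun φ _ => hsum.of_nonneg_of_le (fun n => norm_nonneg _) fun n => hbound n φ,
      tendstoUniformlyOn_tsum_nat hsum fun n φ _ => by
        rw [norm_norm]
        exact hbound n φ,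
      tendstoUniformlyOn_tsum_nat hsum fun n φ _ => hbound n φ⟩
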